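/- Let $(R,\mathfrak m,k)$ be a commutative Noetherian local ring. Complexes are indexed homologically, and $\mathcal D(R)$ is the derived category of $R$-modules. A module $G$ over a ring $S$ is *totally reflexive* if there is an exact complex $F$ of finitely generated free $S$-modules with $\operatorname{Hom}_S(F,S)$ exact and $G\cong\operatorname{im}(F_0\to F_{-1})$. For a local ring $S$ consider the question $(\mathrm{Q}_S)$: if $0\to G_s\to\cdots\to G_0\to 0$ (with $s\ge 0$) is a non-exact complex of totally reflexive $S$-modules whose homology modules have finite length, is $\dim S\le s$? For a complex $X$ put $\inf X=\inf\{i\mid H_i(X)\ne0\}$ (with $\inf\emptyset=\infty$), $\operatorname{Supp}_R X=\{\mathfrak p\in\operatorname{Spec}R\mid X_{\mathfrak p}\text{ is not exact}\}$ and $\dim_R X=\sup\{\dim R/\mathfrak p-\inf X_{\mathfrak p}\mid \mathfrak p\in\operatorname{Spec}R\}$, and let $\operatorname{Gdim}_RX$ be the infimum of $\sup\{l\mid Q_l\neq0\}$ over all complexes $Q$ of totally reflexive $R$-modules with $Q_l=0$ for $l\ll0$ and $Q\simeq X$ in $\mathcal D(R)$. The complex $X\otimes_R^{\mathbf L}N$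 is computed as $P\otimes_RN$ for any projective resolution $P$ of $X$, i.e. any complex $P\simeq X$ of projective modules with $P_l=0$ for $l\ll0$. **Theorem.** (a) If $R$ is Cohen–Macaulay, then $(\mathrm{Q}_R)$ has a positive answer. (b) Let $N$ be a nonzero cyclic $R$-module with $\operatorname{pd}_RN<\infty$, and let $X$ be a non-exact, homologically bounded complex of $R$-modules with finitely generated homology modules, such that $\operatorname{Gdim}_RX<\infty$ and $\operatorname{Supp}_R(X\otimes_R^{\mathbf L}N)=\{\mathfrak m\}$. Assume that $(\mathrm{Q}_S)$ has a positive answer for the local ring $S=R/\operatorname{Ann}_RN$ (in particular this is so if the question has a positive answer for all Noetherian local rings, or, by (a), if $R/\operatorname{Ann}_RN$ is Cohen–Macaulay). Then $$\dim_RN\le\operatorname{Gdim}_RX+\dim_R(X\otimes_R^{\mathbf L}N).$$ -/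

import Mathlib

open CategoryTheory

universe u

noncomputable section

namespace GDim

/-! Complexes of `R`-modules are `CochainComplex (ModuleCat R) ℤ`. The homological degree `l`
is the cohomological degree `-l`, so that the module `X_l` is `X.X (-l)` and the homology
`H_l(X)` is `X.homology (-l)`. -/

/-- A Krull dimension (an element of `{-∞} ∪ ℕ ∪ {∞}`) as an extended real number. -/
def dimToEReal : WithBot ℕ∞ → EReal
  | ⊥ => ⊥
  | (n : ℕ∞) => ((n : ENNReal) : EReal)

/-- Cohen-Macaulay local ring: the maximal ideal contains an `R`-regular sequence whose length is
the Krull dimension of `R`, that is, `depth R = dim R`. -/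
def IsCohenMacaulayLocal (R : Type u) [CommRing R] [IsLocalRing R] : Prop :=
  ∃ rs : List R, (∀ r ∈ rs, r ∈ IsLocalRing.maximalIdeal R) ∧
    RingTheory.Sequence.IsRegular R rs ∧ ((rs.length : ℕ) : WithBot ℕ∞) = ringKrullDim R

section

variable {R : Type u} [CommRing R]

/-- `M` is totally reflexive: there is an exact complex `F` of finitely generated free modules
such that `Hom(F, R)` is exact and `M ≅ im (F_0 → F_{-1})`. -/
def IsTotallyReflexive (M : ModuleCat.{u} R) : Prop :=
  ∃ F : CochainComplex (ModuleCat.{u} R) ℤ,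
    (∀ i, Module.Finite R (F.X i) ∧ Module.Free R (F.X i)) ∧
    F.Acyclic ∧
    (∀ i : ℤ, Function.Exact (F.d (i + 1) (i + 2)).hom.dualMap (F.d i (i + 1)).hom.dualMap) ∧
    Nonempty (M ≃ₗ[R] LinearMap.range (F.d 0 1).hom)

/-- `X ≃ Y`: the complexes `X` and `Y` are isomorphic in the derived category. -/
def DerivedIso (X Y : CochainComplex (ModuleCat.{u} R) ℤ) : Prop :=
  letI := HasDerivedCategory.standard (ModuleCat.{u} R)
  Nonempty (DerivedCategory.Q.obj X ≅ DerivedCategory.Q.obj Y)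

/-- `X` is bounded to the right: `X_l = 0` for all sufficiently small homological degrees `l`. -/
def IsBoundedRight (X : CochainComplex (ModuleCat.{u} R) ℤ) : Prop :=
  ∃ n : ℤ, X.IsStrictlyLE n

/-- `X` is homologically bounded. -/
def IsHomologicallyBounded (X : CochainComplex (ModuleCat.{u} R) ℤ) : Prop :=
  ∃ a b : ℤ, ∀ i : ℤ, ¬ Limits.IsZero (X.homology i) → a ≤ i ∧ i ≤ b

/-- `inf X = inf {l | H_l(X) ≠ 0}`, with `inf ∅ = ∞`. -/
def homInf (X : CochainComplex (ModuleCat.{u} R) ℤ) : EReal :=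
  sInf {e | ∃ l : ℤ, ¬ Limits.IsZero (X.homology (-l)) ∧ e = ((l : ℝ) : EReal)}

/-- `sup {l | Q_l ≠ 0}`, with `sup ∅ = -∞`. -/
def termSup (Q : CochainComplex (ModuleCat.{u} R) ℤ) : EReal :=
  sSup {e | ∃ l : ℤ, ¬ Limits.IsZero (Q.X (-l)) ∧ e = ((l : ℝ) : EReal)}

/-- The G-dimension of `X`: the infimum of `sup {l | Q_l ≠ 0}` over all bounded to the right
complexes `Q` of totally reflexive modules that are isomorphic to `X` in the derived category. -/
def gdim (X : CochainComplex (ModuleCat.{u} R) ℤ) : EReal :=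
  sInf {e | ∃ Q : CochainComplex (ModuleCat.{u} R) ℤ, IsBoundedRight Q ∧
    (∀ i, IsTotallyReflexive (Q.X i)) ∧ DerivedIso Q X ∧ e = termSup Q}

/-- The localization `X_p` of a complex, a complex of modules over `R_p`. -/
def localize (X : CochainComplex (ModuleCat.{u} R) ℤ) (p : PrimeSpectrum R) :
    CochainComplex (ModuleCat.{u} (Localization p.asIdeal.primeCompl)) ℤ :=
  ((ModuleCat.localizedModuleFunctor.{u} p.asIdeal.primeCompl).mapHomologicalComplex
    (ComplexShape.up ℤ)).obj X

/-- The support of `X`: the primes `p` such that `X_p` is not exact. -/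
def supp (X : CochainComplex (ModuleCat.{u} R) ℤ) : Set (PrimeSpectrum R) :=
  {p | ¬ (localize X p).Acyclic}

/-- The dimension of `X`: `sup {dim R/p - inf X_p | p ∈ Spec R}`. -/
def cdim (X : CochainComplex (ModuleCat.{u} R) ℤ) : EReal :=
  ⨆ p : PrimeSpectrum R, dimToEReal (ringKrullDim (R ⧸ p.asIdeal)) - homInf (localize X p)

/-- A projective resolution of `X`: a bounded to the right complex of projective modules that is
isomorphic to `X` in the derived category. -/
structure ProjRes (X : CochainComplex (ModuleCat.{u} R) ℤ) where
  /-- the underlying complex -/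
  complex : CochainComplex (ModuleCat.{u} R) ℤ
  projective : ∀ i, Module.Projective R (complex.X i)
  bounded : IsBoundedRight complex
  iso : DerivedIso complex X

/-- The derived tensor product `X ⊗ᴸ N` of a complex `X` and a module `N`, computed by a
projective resolution `P` of `X`: the complex `P ⊗ N`. It does not depend on `P` up to
isomorphism in the derived category. -/
def ProjRes.derivedTensor {X : CochainComplex (ModuleCat.{u} R) ℤ} (P : ProjRes X)
    (N : Type u) [AddCommGroup N] [Module R N] : CochainComplex (ModuleCat.{u} R) ℤ :=
  ((MonoidalCategory.tensorRight (ModuleCat.of R N)).mapHomologicalComplex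
    (ComplexShape.up ℤ)).obj P.complex

end

/-- The new intersection property for complexes of totally reflexive modules over `R`: for every
non-exact complex `0 → G_s → ⋯ → G_0 → 0` of totally reflexive modules with homology of finite
length, one has `dim R ≤ s`. -/
def TotallyReflexiveNewIntersection (R : Type u) [CommRing R] : Prop :=
  ∀ (s : ℕ) (G : CochainComplex (ModuleCat.{u} R) ℤ),
    G.IsStrictlyGE (-(s : ℤ)) → G.IsStrictlyLE 0 →
    (∀ i, IsTotallyReflexive (G.X i)) →
    (∀ i, IsFiniteLength R (G.homology i)) →
    ¬ G.Acyclic →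
    ringKrullDim R ≤ ((s : ℕ) : WithBot ℕ∞)

end GDim

end

/-! For (a), let `d` be the depth, hence the dimension, of `R`. A totally reflexive module embeds in
a finite free module with totally reflexive cokernel, so iterating shows that its depth is at least
`d`. If `s < d`, the acyclicity argument of Peskine and Szpiro applies: starting at the left end,
the boundaries have depth at least 2, the cycles have depth at least 1, so each homology module has
depth at least 1 and, being of finite length, vanishes. The complex is then exact, a contradiction
(`IsCohenMacaulayLocal.newIntersection`).

For (b), `N` is isomorphic to `S = R/Ann N`. Let `Q` be a resolution of `X` by totally reflexive
modules. Since `pd N` is finite, exact complexes of totally reflexive modules stay exact after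
tensoring with `N` (`exact_rTensor_of_torIndependent`, `IsTotallyReflexive.torIndependent`). This
has two consequences. Applied to the cone of a quasi-isomorphism from a projective resolution to
`Q`, it shows that `Q ⊗ N` computes the derived tensor product. Applied to complete resolutions and
their duals, it shows that `S ⊗ Q` consists of totally reflexive `S`-modules
(`IsTotallyReflexive.baseChange`). The support condition makes all homology of finite length.

Let `n` be the last cohomological degree with nonzero homology. Replacing degree `n` of `S ⊗ Q` by
its cycles and dropping everything beyond keeps the terms totally reflexive, because kernels of
surjections between such modules are totally reflexive (`IsTotallyReflexive.kernel`). The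
intersection property over `S` bounds `dim S` by the length `sup Q + n` of the truncated complex,
and `n` is at most the dimension of the tensor product, as seen at the closed point. Taking the
infimum over `Q` gives the claim. -/

noncomputable section

namespace GDim

/-! ### Short exact sequences and factorization of linear maps -/

section LinearAlgebra

variable {R : Type*} [CommRing R]

/-- The sequence `0 → A → B → C → 0` is exact. -/
structure IsSES {A B C : Type*} [AddCommGroup A] [Module R A] [AddCommGroup B] [Module R B]
    [AddCommGroup C] [Module R C] (f : A →ₗ[R] B) (g : B →ₗ[R] C) : Prop where
  inj : Function.Injective f
  exact : Function.Exact f g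
  surj : Function.Surjective g

variable {A B C D : Type*} [AddCommGroup A] [Module R A] [AddCommGroup B] [Module R B]
    [AddCommGroup C] [Module R C] [AddCommGroup D] [Module R D]

lemma exists_comp_eq_of_ker_le {σ : A →ₗ[R] B} (hσ : Function.Surjective σ) (θ : A →ₗ[R] C)
    (h : ∀ a, σ a = 0 → θ a = 0) : ∃ ψ : B →ₗ[R] C, ψ ∘ₗ σ = θ := by
  refine ⟨(Submodule.liftQ (LinearMap.ker σ) θ fun a ha => h a ha) ∘ₗ
    (σ.quotKerEquivOfSurjective hσ).symm.toLinearMap, ?_⟩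
  ext a
  have : (σ.quotKerEquivOfSurjective hσ).symm (σ a) = Submodule.Quotient.mk a := by
    rw [LinearEquiv.symm_apply_eq]; rfl
  simpa [this] using Submodule.liftQ_apply _ _ _

lemma exists_comp_eq_of_range_le {f : A →ₗ[R] B} (hf : Function.Injective f) (h : C →ₗ[R] B)
    (hr : ∀ c, ∃ a, f a = h c) : ∃ k : C →ₗ[R] A, f ∘ₗ k = h := by
  exact ⟨LinearMap.codRestrictOfInjective h f hf fun c => hr c,
    LinearMap.codRestrictOfInjective_comp ..⟩

lemma isSES_ker {g : B →ₗ[R] C} (hg : Function.Surjective g) :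
    IsSES (LinearMap.ker g).subtype g :=
  ⟨Subtype.val_injective, fun y => by simp, hg⟩

lemma isSES_mkQ {f : A →ₗ[R] B} (hf : Function.Injective f) :
    IsSES f (LinearMap.range f).mkQ :=
  ⟨hf, fun y => by simp, Submodule.mkQ_surjective _⟩

end LinearAlgebra

/-! ### Vanishing of Ext¹(-, R), phrased as extension of linear forms -/

variable {R : Type u} [CommRing R]

/-- `Ext¹(M, R) = 0`: linear forms extend along inclusions with cokernel `M`. -/
def ExtendsForms (R : Type u) [CommRing R] (M : Type u) [AddCommGroup M] [Module R M] : Prop :=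
  ∀ (A B : Type u) [AddCommGroup A] [Module R A] [AddCommGroup B] [Module R B]
    (f : A →ₗ[R] B) (g : B →ₗ[R] M), IsSES f g → ∀ φ : A →ₗ[R] R, ∃ ψ : B →ₗ[R] R, ψ ∘ₗ f = φ

section ExtendsForms

variable {M A B : Type u} [AddCommGroup M] [Module R M] [AddCommGroup A] [Module R A]
  [AddCommGroup B] [Module R B]

/-- One projective cover decides all extensions: any extension `B` of `M` by `A` is the quotient of
`A × F` by the copy of `K` embedded through `(-k, i)`. Forms on `A` and `F` that agree along `K`
therefore glue to a form on `B`. -/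
lemma ExtendsForms.of_cover {K F : Type u} [AddCommGroup K] [Module R K] [AddCommGroup F]
    [Module R F] [Module.Projective R F] {i : K →ₗ[R] F} {p : F →ₗ[R] M} (h : IsSES i p)
    (he : ∀ φ : K →ₗ[R] R, ∃ ψ : F →ₗ[R] R, ψ ∘ₗ i = φ) : ExtendsForms R M := by
  intro A B _ _ _ _ f g hfg φ
  obtain ⟨l, hl⟩ := Module.projective_lifting_property g p hfg.surj
  have hl' : ∀ x, g (l x) = p x := fun x => LinearMap.congr_fun hl x
  obtain ⟨k, hk⟩ := exists_comp_eq_of_range_le hfg.inj (l ∘ₗ i) (fun c => by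
    apply (hfg.exact _).1
    simp [hl', h.exact.apply_apply_eq_zero])
  have hk' : ∀ x, f (k x) = l (i x) := fun x => LinearMap.congr_fun hk x
  obtain ⟨χ, hχ⟩ := he (φ ∘ₗ k)
  have hχ' : ∀ x, χ (i x) = φ (k x) := fun x => LinearMap.congr_fun hχ x
  have hs : Function.Surjective (f.coprod l) := by
    intro b
    obtain ⟨x, hx⟩ := h.surj (g b)
    obtain ⟨a, ha⟩ := (hfg.exact (b - l x)).1 (by simp [hl', hx])
    exact ⟨(a, x), by simp [ha]⟩
  obtain ⟨ψ, hψ⟩ := exists_comp_eq_of_ker_le hs (φ.coprod χ) (by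
    rintro ⟨a, x⟩ hax
    simp only [LinearMap.coprod_apply] at hax ⊢
    have h0 := congrArg g hax
    simp only [map_add, hfg.exact.apply_apply_eq_zero, hl', zero_add, map_zero] at h0
    obtain ⟨κ, rfl⟩ := (h.exact _).1 h0
    have : a = - k κ := hfg.inj (by rw [map_neg, hk']; exact eq_neg_of_add_eq_zero_left hax)
    rw [hχ', this]; simp)
  refine ⟨ψ, ?_⟩
  ext a
  simpa using LinearMap.congr_fun hψ (a, 0)

lemma ExtendsForms.of_projective [Module.Projective R M] : ExtendsForms R M := by
  intro A B _ _ _ _ f g hfg φ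
  obtain ⟨l, hl⟩ := Module.projective_lifting_property g (LinearMap.id) hfg.surj
  have hl' : ∀ x, g (l x) = x := fun x => LinearMap.congr_fun hl x
  obtain ⟨k, hk⟩ := exists_comp_eq_of_range_le hfg.inj (LinearMap.id - l ∘ₗ g) (fun c => by
    apply (hfg.exact _).1
    simp [hl'])
  have hk' : ∀ x, f (k x) = x - l (g x) := fun x => LinearMap.congr_fun hk x
  refine ⟨φ ∘ₗ k, ?_⟩
  ext a
  have : k (f a) = a := hfg.inj (by simp [hk', hfg.exact.apply_apply_eq_zero])
  simp [this]

lemma ExtendsForms.extend_to_free {L : Type u} [AddCommGroup L] [Module R L] [Module.Free R L]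
    [Module.Finite R L] (hM : ExtendsForms R M) {f : A →ₗ[R] B} {g : B →ₗ[R] M} (h : IsSES f g)
    (φ : A →ₗ[R] L) : ∃ ψ : B →ₗ[R] L, ψ ∘ₗ f = φ := by
  let b := Module.Free.chooseBasis R L
  choose ψ hψ using fun j => hM A B f g h (b.coord j ∘ₗ φ)
  refine ⟨b.equivFun.symm.toLinearMap ∘ₗ LinearMap.pi ψ, ?_⟩
  ext a
  apply b.equivFun.injective
  ext j
  have := LinearMap.congr_fun (hψ j) a
  simp only [LinearMap.comp_apply, LinearEquiv.coe_coe, LinearEquiv.apply_symm_apply,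
    LinearMap.pi_apply] at this ⊢
  exact this

/-- The form is extended in two stages, through the preimage of `A` in the middle term: that
preimage is an extension of `A`, and the quotient by it is `B`. -/
lemma ExtendsForms.extension {i : A →ₗ[R] M} {p : M →ₗ[R] B} (h : IsSES i p)
    (hA : ExtendsForms R A) (hB : ExtendsForms R B) : ExtendsForms R M := by
  intro U V _ _ _ _ f g hfg φ
  let f' : U →ₗ[R] LinearMap.ker (p ∘ₗ g) := f.codRestrict _ fun c => by
    simp [hfg.exact.apply_apply_eq_zero]
  have hf'' : ∀ x, (f' x : V) = f x := fun x => rfl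
  obtain ⟨g', hg'⟩ := exists_comp_eq_of_range_le h.inj (g ∘ₗ (LinearMap.ker (p ∘ₗ g)).subtype)
    (fun c => (h.exact _).1 c.2)
  have hg'' : ∀ x : LinearMap.ker (p ∘ₗ g), i (g' x) = g x := fun x => LinearMap.congr_fun hg' x
  have hs : IsSES f' g' := ⟨fun x y hxy => hfg.inj (by rw [← hf'', ← hf'', hxy]),
    fun y => by
      rw [← h.inj.eq_iff, map_zero, hg'', hfg.exact]
      exact ⟨fun ⟨x, hx⟩ => ⟨x, Subtype.ext (by rw [hf'', hx])⟩,
        fun ⟨x, hx⟩ => ⟨x, by rw [← hf'', hx]⟩⟩,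
    fun a => by
      obtain ⟨v, hv⟩ := hfg.surj (i a)
      exact ⟨⟨v, by simp [hv, h.exact.apply_apply_eq_zero]⟩, h.inj (by rw [hg'', hv])⟩⟩
  obtain ⟨ψ, hψ⟩ := hA _ _ f' g' hs φ
  obtain ⟨χ, hχ⟩ := hB _ _ _ _
    (isSES_ker (g := p ∘ₗ g) (h.surj.comp hfg.surj)) ψ
  refine ⟨χ, ?_⟩
  ext x
  have := LinearMap.congr_fun hχ (f' x)
  simp only [LinearMap.comp_apply, Submodule.subtype_apply, hf''] at this
  rw [LinearMap.comp_apply, this, ← hψ, LinearMap.comp_apply]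

/-- The extension of `A` is pulled back along `r` to an extension `W` of `M`; a form extended to `W`
is then restricted along `v ↦ (v, s (g v))`. -/
lemma ExtendsForms.of_retract (hM : ExtendsForms R M) (s : A →ₗ[R] M) (r : M →ₗ[R] A)
    (hrs : ∀ a, r (s a) = a) : ExtendsForms R A := by
  intro U V _ _ _ _ f g hfg φ
  let W := LinearMap.ker (g.coprod (-r))
  have hW : ∀ w : V × M, w ∈ W ↔ g w.1 = r w.2 := fun w => by
    simp [W, LinearMap.coprod_apply, ← sub_eq_add_neg, sub_eq_zero]
  obtain ⟨ψ, hψ⟩ := hM U W ((LinearMap.inl R V M ∘ₗ f).codRestrict W fun u => by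
      simp [hW, hfg.exact.apply_apply_eq_zero]) (LinearMap.snd R V M ∘ₗ W.subtype)
    ⟨fun x y hxy => hfg.inj (congrArg (fun w : W => w.1.1) hxy), fun w => by
      constructor
      · intro hw
        have hw : w.1.2 = 0 := hw
        obtain ⟨u, hu⟩ := (hfg.exact w.1.1).1 (by rw [(hW _).1 w.2, hw, map_zero])
        exact ⟨u, Subtype.ext (Prod.ext hu hw.symm)⟩
      · rintro ⟨u, rfl⟩
        rfl, fun m => by
      obtain ⟨v, hv⟩ := hfg.surj (r m)
      exact ⟨⟨(v, m), (hW _).2 hv⟩, rfl⟩⟩ φ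
  refine ⟨ψ ∘ₗ (LinearMap.id.prod (s ∘ₗ g)).codRestrict W (fun v => (hW _).2 (by simp [hrs])), ?_⟩
  ext u
  rw [← hψ]
  simp only [LinearMap.comp_apply]
  congr 1
  exact Subtype.ext (Prod.ext rfl (show s (g (f u)) = 0 by simp [hfg.exact.apply_apply_eq_zero]))

end ExtendsForms

/-! ### A coinductive criterion for total reflexivity -/

/-- The prescribed element sits at index 1 because, in the complex spliced from the chain, the image
of the differential from degree 0 to degree 1 is the module at index 1. -/
lemma exists_int_chain {α : Type*} {r : α → α → Prop} (hr : ∀ x, ∃ y, r x y)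
    (hl : ∀ y, ∃ x, r x y) (x : α) : ∃ z : ℤ → α, z 1 = x ∧ ∀ i, r (z i) (z (i + 1)) := by
  choose a ha using hr
  choose b hb using hl
  let z : ℤ → α
    | .ofNat 0 => b x
    | .ofNat (n + 1) => a^[n] x
    | .negSucc n => b^[n + 2] x
  refine ⟨z, rfl, ?_⟩
  rintro (⟨_ | n⟩ | ⟨_ | n⟩)
  · exact hb x
  · change r (a^[n] x) (a^[n + 1] x)
    rw [Function.iterate_succ_apply']
    exact ha _
  · exact hb _
  · change r (b^[n + 3] x) (b^[n + 2] x)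
    rw [Function.iterate_succ_apply']
    exact hb _

lemma acyclic_iff_exact {X : CochainComplex (ModuleCat.{u} R) ℤ} :
    X.Acyclic ↔ ∀ i j k : ℤ, i + 1 = j → j + 1 = k →
      Function.Exact (X.d i j).hom (X.d j k).hom := by
  constructor
  · intro h i j k hij hjk
    have := h j
    rw [X.exactAt_iff' i j k (by simp [← hij]) (by simp [← hjk])] at this
    exact (ShortComplex.ShortExact.moduleCat_exact_iff_function_exact _).1 this
  · intro h j
    rw [X.exactAt_iff' (j - 1) j (j + 1) (by simp) (by simp)]
    exact (ShortComplex.ShortExact.moduleCat_exact_iff_function_exact _).2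
      (h _ _ _ (by simp) rfl)

/-- A class of modules closed under taking suitable syzygies and cosyzygies with respect to
finite free modules, on which `Ext¹(-, R)` vanishes, consists of totally reflexive modules. -/
theorem isTotallyReflexive_of_coinductive (C : ModuleCat.{u} R → Prop)
    (hr : ∀ M, C M → ∃ (F M' : ModuleCat.{u} R) (f : M →ₗ[R] F) (g : F →ₗ[R] M'),
      Module.Free R F ∧ Module.Finite R F ∧ IsSES f g ∧ C M')
    (hl : ∀ M', C M' → ∃ (F M : ModuleCat.{u} R) (f : M →ₗ[R] F) (g : F →ₗ[R] M'),
      Module.Free R F ∧ Module.Finite R F ∧ IsSES f g ∧ C M)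
    (he : ∀ M, C M → ExtendsForms R M) (M : ModuleCat.{u} R) (hM : C M) :
    IsTotallyReflexive M := by
  obtain ⟨z, hz, hzr⟩ := exists_int_chain (α := {M // C M})
    (r := fun M M' => ∃ (F : ModuleCat.{u} R) (f : M.1 →ₗ[R] F) (g : F →ₗ[R] M'.1),
      Module.Free R F ∧ Module.Finite R F ∧ IsSES f g)
    (fun M => by
      obtain ⟨F, M', f, g, h1, h2, h3, h4⟩ := hr M.1 M.2
      exact ⟨⟨M', h4⟩, F, f, g, h1, h2, h3⟩)
    (fun M => by
      obtain ⟨F, M', f, g, h1, h2, h3, h4⟩ := hl M.1 M.2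
      exact ⟨⟨M', h4⟩, F, f, g, h1, h2, h3⟩) ⟨M, hM⟩
  choose F f g hfree hfin hses using hzr
  -- Splicing: `F i` lies between the modules at `i` and `i + 1`, and the differential passes
  -- through the module at `i + 1`.
  let d : ∀ i, F i ⟶ F (i + 1) := fun i => ModuleCat.ofHom (f (i + 1) ∘ₗ g i)
  have hd : ∀ i, d i ≫ d (i + 1) = 0 := fun i => by
    ext x
    simp [d, (hses (i + 1)).exact.apply_apply_eq_zero]
  have hdd : ∀ i, ((CochainComplex.of (fun i => F i) d hd).d i (i + 1)).hom = f (i + 1) ∘ₗ g i :=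
    fun i => congrArg ModuleCat.Hom.hom (CochainComplex.of_d (fun i => F i) d i)
  refine ⟨CochainComplex.of (fun i => F i) d hd, fun i => ⟨hfin i, hfree i⟩, ?_, ?_, ?_⟩
  · rw [acyclic_iff_exact]
    rintro i _ _ rfl rfl
    rw [hdd, hdd]
    intro y
    simp only [LinearMap.comp_apply]
    rw [map_eq_zero_iff _ (hses _).inj, (hses _).exact]
    constructor
    · rintro ⟨x, rfl⟩
      obtain ⟨w, rfl⟩ := (hses i).surj x
      exact ⟨w, rfl⟩
    · rintro ⟨w, rfl⟩
      exact ⟨_, rfl⟩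
  · intro i
    have hd2 : ∀ j, j = i + 1 + 1 →
        Function.Exact ((CochainComplex.of (fun i => F i) d hd).d (i + 1) j).hom.dualMap
        ((CochainComplex.of (fun i => F i) d hd).d i (i + 1)).hom.dualMap := by
      rintro _ rfl
      rw [hdd, hdd]
      intro φ
      constructor
      · intro hφ
        -- A form killed by the incoming differential descends to the next syzygy, and the vanishing
        -- of Ext¹ extends it from there to the next free module.
        obtain ⟨χ, hχ⟩ := exists_comp_eq_of_ker_le (hses (i + 1)).surj φ (fun a ha => by
          obtain ⟨x, rfl⟩ := ((hses (i + 1)).exact a).1 ha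
          obtain ⟨w, rfl⟩ := (hses i).surj x
          exact LinearMap.congr_fun hφ w)
        obtain ⟨ψ, hψ⟩ := he _ (z (i + 1 + 1 + 1)).2 _ _ _ _ (hses (i + 1 + 1)) χ
        refine ⟨ψ, ?_⟩
        rw [LinearMap.dualMap_apply', ← LinearMap.comp_assoc, hψ, hχ]
      · rintro ⟨ψ, rfl⟩
        ext x
        simp [(hses (i + 1)).exact.apply_apply_eq_zero]
    exact hd2 _ (by ring)
  · have key : LinearMap.range ((CochainComplex.of (fun i => F i) d hd).d 0 1).hom =
        LinearMap.range (f 1) := by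
      have := hdd 0
      rw [show ((CochainComplex.of (fun i => F i) d hd).d 0 1).hom = f (0 + 1) ∘ₗ g 0 from this]
      exact LinearMap.range_comp_of_range_eq_top _ (LinearMap.range_eq_top.2 (hses 0).surj)
    have e : M = (z 1).1 := by rw [hz]
    rw [key]
    exact ⟨(eqToIso e).toLinearEquiv.trans (LinearEquiv.ofInjective _ (hses 1).inj)⟩

end GDim

/-! ### Syzygies, extensions and kernels of totally reflexive modules -/

namespace GDim

variable {R : Type u} [CommRing R]

/-- `M` is isomorphic to one of the syzygies of a complete resolution. -/
def IsSyzygyOf (M : ModuleCat.{u} R) : Prop :=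
  ∃ F : CochainComplex (ModuleCat.{u} R) ℤ,
    (∀ i, Module.Finite R (F.X i) ∧ Module.Free R (F.X i)) ∧
    F.Acyclic ∧
    (∀ i j k : ℤ, i + 1 = j → j + 1 = k →
      Function.Exact (F.d j k).hom.dualMap (F.d i j).hom.dualMap) ∧
    ∃ i j : ℤ, i + 1 = j ∧ Nonempty (M ≃ₗ[R] LinearMap.range (F.d i j).hom)

lemma IsTotallyReflexive.isSyzygyOf {M : ModuleCat.{u} R} (h : IsTotallyReflexive M) :
    IsSyzygyOf M := by
  obtain ⟨F, h1, h2, h3, h4⟩ := h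
  refine ⟨F, h1, h2, ?_, 0, 1, rfl, h4⟩
  rintro i j k rfl hk
  obtain rfl : k = i + 2 := by lia
  exact h3 i

lemma isSES_range {A B C : Type*} [AddCommGroup A] [Module R A] [AddCommGroup B] [Module R B]
    [AddCommGroup C] [Module R C] {f : A →ₗ[R] B} {g : B →ₗ[R] C} (h : Function.Exact f g) :
    IsSES (LinearMap.range f).subtype g.rangeRestrict :=
  ⟨Subtype.val_injective, fun y => by
    rw [← Subtype.val_injective.eq_iff]
    simpa using h y, g.surjective_rangeRestrict⟩

section

variable {A B C D E : Type*} [AddCommGroup A] [Module R A] [AddCommGroup B] [Module R B]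
    [AddCommGroup C] [Module R C] [AddCommGroup D] [Module R D] [AddCommGroup E] [Module R E]

lemma IsSES.comp_equiv_right {f : A →ₗ[R] B} {g : B →ₗ[R] C} (h : IsSES f g) (e : C ≃ₗ[R] D) :
    IsSES f (e.toLinearMap ∘ₗ g) :=
  ⟨h.inj, fun y => by simpa using h.exact y, e.surjective.comp h.surj⟩

lemma IsSES.comp_equiv_left {f : A →ₗ[R] B} {g : B →ₗ[R] C} (h : IsSES f g) (e : D ≃ₗ[R] A) :
    IsSES (f ∘ₗ e.toLinearMap) g :=
  ⟨h.inj.comp e.injective, fun y => by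
    rw [h.exact y]
    exact ⟨fun ⟨x, hx⟩ => ⟨e.symm x, by simp [hx]⟩, fun ⟨x, hx⟩ => ⟨e x, hx⟩⟩, h.surj⟩

end

lemma IsSyzygyOf.right {M : ModuleCat.{u} R} (h : IsSyzygyOf M) :
    ∃ (F M' : ModuleCat.{u} R) (f : M →ₗ[R] F) (g : F →ₗ[R] M'),
      Module.Free R F ∧ Module.Finite R F ∧ IsSES f g ∧ IsSyzygyOf M' := by
  obtain ⟨F, h1, h2, h3, i, j, hij, ⟨e⟩⟩ := h
  exact ⟨F.X j, ModuleCat.of R (LinearMap.range (F.d j (j + 1)).hom), _, _, (h1 j).2, (h1 j).1,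
    (isSES_range (acyclic_iff_exact.1 h2 i j (j + 1) hij rfl)).comp_equiv_left e,
    F, h1, h2, h3, j, j + 1, rfl, ⟨LinearEquiv.refl _ _⟩⟩

lemma IsSyzygyOf.left {M : ModuleCat.{u} R} (h : IsSyzygyOf M) :
    ∃ (F M' : ModuleCat.{u} R) (f : M' →ₗ[R] F) (g : F →ₗ[R] M),
      Module.Free R F ∧ Module.Finite R F ∧ IsSES f g ∧ IsSyzygyOf M' := by
  obtain ⟨F, h1, h2, h3, i, j, hij, ⟨e⟩⟩ := h
  exact ⟨F.X i, ModuleCat.of R (LinearMap.range (F.d (i - 1) i).hom), _, _, (h1 i).2, (h1 i).1,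
    (isSES_range (acyclic_iff_exact.1 h2 (i - 1) i j (by simp) hij)).comp_equiv_right e.symm,
    F, h1, h2, h3, i - 1, i, by simp, ⟨LinearEquiv.refl _ _⟩⟩

/-- A form on the module of boundaries, composed with the map onto it, vanishes on the previous
boundaries; exactness of the dual complex then provides the extension. By `ExtendsForms.of_cover`
this single cover is enough. -/
lemma IsSyzygyOf.extendsForms {M : ModuleCat.{u} R} (h : IsSyzygyOf M) : ExtendsForms R M := by
  obtain ⟨F, h1, h2, h3, i, j, hij, ⟨e⟩⟩ := h
  have := (h1 i).2
  refine ExtendsForms.of_cover ((isSES_range (acyclic_iff_exact.1 h2 (i - 1) i j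
    (by simp) hij)).comp_equiv_right e.symm) fun φ => ?_
  obtain ⟨ψ, hψ⟩ := (h3 (i - 1 - 1) (i - 1) i (by simp) (by simp)
    (φ ∘ₗ (F.d (i - 1) i).hom.rangeRestrict)).1 (by
      ext x
      have : (F.d (i - 1) i).hom.rangeRestrict ((F.d (i - 1 - 1) (i - 1)).hom x) = 0 := by
        apply Subtype.ext
        exact ((acyclic_iff_exact.1 h2 (i - 1 - 1) (i - 1) i (by simp) (by simp)) _).2 ⟨x, rfl⟩
      simp [this])
  refine ⟨ψ, ?_⟩
  ext ⟨_, x, rfl⟩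
  exact LinearMap.congr_fun hψ x

/-- Invoking the criterion avoids shifting the complete resolution to bring the syzygy to degree 0.
-/
lemma IsSyzygyOf.isTotallyReflexive {M : ModuleCat.{u} R} (h : IsSyzygyOf M) :
    IsTotallyReflexive M :=
  isTotallyReflexive_of_coinductive IsSyzygyOf (fun _ h => h.right) (fun _ h => h.left)
    (fun _ h => h.extendsForms) M h

namespace IsTotallyReflexive

lemma right {M : ModuleCat.{u} R} (h : IsTotallyReflexive M) :
    ∃ (F M' : ModuleCat.{u} R) (f : M →ₗ[R] F) (g : F →ₗ[R] M'),
      Module.Free R F ∧ Module.Finite R F ∧ IsSES f g ∧ IsTotallyReflexive M' := by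
  obtain ⟨F, M', f, g, h1, h2, h3, h4⟩ := h.isSyzygyOf.right
  exact ⟨F, M', f, g, h1, h2, h3, h4.isTotallyReflexive⟩

lemma left {M : ModuleCat.{u} R} (h : IsTotallyReflexive M) :
    ∃ (F M' : ModuleCat.{u} R) (f : M' →ₗ[R] F) (g : F →ₗ[R] M),
      Module.Free R F ∧ Module.Finite R F ∧ IsSES f g ∧ IsTotallyReflexive M' := by
  obtain ⟨F, M', f, g, h1, h2, h3, h4⟩ := h.isSyzygyOf.left
  exact ⟨F, M', f, g, h1, h2, h3, h4.isTotallyReflexive⟩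

lemma extendsForms {M : ModuleCat.{u} R} (h : IsTotallyReflexive M) : ExtendsForms R M :=
  h.isSyzygyOf.extendsForms

lemma finite {M : ModuleCat.{u} R} (h : IsTotallyReflexive M) : Module.Finite R M := by
  obtain ⟨F, M', f, g, h1, h2, h3, h4⟩ := h.left
  exact Module.Finite.of_surjective g h3.surj

lemma of_equiv {M M' : ModuleCat.{u} R} (h : IsTotallyReflexive M) (e : M ≃ₗ[R] M') :
    IsTotallyReflexive M' := by
  obtain ⟨F, h1, h2, h3, ⟨e'⟩⟩ := h
  exact ⟨F, h1, h2, h3, ⟨e.symm.trans e'⟩⟩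

lemma of_free (M : ModuleCat.{u} R) [Module.Free R M] [Module.Finite R M] :
    IsTotallyReflexive M := by
  refine isTotallyReflexive_of_coinductive
    (fun M => Module.Free R M ∧ Module.Finite R M) ?_ ?_ ?_ M ⟨inferInstance, inferInstance⟩
  · rintro M ⟨h1, h2⟩
    exact ⟨M, ModuleCat.of R PUnit, LinearMap.id, 0, h1, h2,
      ⟨Function.injective_id, fun y => by simp, fun y => ⟨0, rfl⟩⟩, inferInstance, inferInstance⟩
  · rintro M ⟨h1, h2⟩
    exact ⟨M, ModuleCat.of R PUnit, 0, LinearMap.id, h1, h2,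
      ⟨fun x y _ => rfl, fun y => by simp [eq_comm], Function.surjective_id⟩,
      inferInstance, inferInstance⟩
  · rintro M ⟨h1, h2⟩
    exact ExtendsForms.of_projective

/-- Totally reflexive modules are closed under extensions. -/
theorem extension {A D B : ModuleCat.{u} R} (hA : IsTotallyReflexive A)
    (hB : IsTotallyReflexive B) {i : A →ₗ[R] D} {p : D →ₗ[R] B} (h : IsSES i p) :
    IsTotallyReflexive D := by
  refine isTotallyReflexive_of_coinductive
    (fun D => ∃ (A B : ModuleCat.{u} R) (i : A →ₗ[R] D) (p : D →ₗ[R] B),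
      IsTotallyReflexive A ∧ IsTotallyReflexive B ∧ IsSES i p) ?_ ?_ ?_ D ⟨A, B, i, p, hA, hB, h⟩
  · rintro D ⟨A, B, i, p, hA, hB, h⟩
    obtain ⟨F, A', iA, qA, _, _, sA, hA'⟩ := hA.right
    obtain ⟨G, B', iB, qB, _, _, sB, hB'⟩ := hB.right
    -- Horseshoe construction on the right. Ext¹(B, R) = 0 plays the role of injectivity of `F`: the
    -- embedding of `A` extends to `D`.
    obtain ⟨e, he⟩ := hB.extendsForms.extend_to_free h iA
    have he' : ∀ a, e (i a) = iA a := fun a => LinearMap.congr_fun he a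
    have hj : Function.Injective (e.prod (iB ∘ₗ p)) := by
      rw [injective_iff_map_eq_zero]
      intro d hd
      have h2 : iB (p d) = 0 := congrArg Prod.snd hd
      rw [map_eq_zero_iff _ sB.inj] at h2
      obtain ⟨a, rfl⟩ := (h.exact d).1 h2
      have h1 : iA a = 0 := by rw [← he']; exact congrArg Prod.fst hd
      rw [map_eq_zero_iff _ sA.inj] at h1
      simp [h1]
    set N := LinearMap.range (e.prod (iB ∘ₗ p)) with hN
    obtain ⟨u, hu⟩ := exists_comp_eq_of_ker_le sA.surj (N.mkQ ∘ₗ LinearMap.inl R F G) (by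
      intro x hx
      obtain ⟨a, rfl⟩ := (sA.exact x).1 hx
      simp only [LinearMap.comp_apply, Submodule.mkQ_apply, Submodule.Quotient.mk_eq_zero]
      exact ⟨i a, by simp [he', h.exact.apply_apply_eq_zero]⟩)
    have hu' : ∀ x, u (qA x) = N.mkQ (x, 0) := fun x => LinearMap.congr_fun hu x
    obtain ⟨v, hv⟩ := exists_comp_eq_of_ker_le N.mkQ_surjective (qB ∘ₗ LinearMap.snd R F G) (by
      intro x hx
      simp only [Submodule.mkQ_apply, Submodule.Quotient.mk_eq_zero] at hx
      obtain ⟨d, rfl⟩ := hx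
      simp [sB.exact.apply_apply_eq_zero])
    have hv' : ∀ x, v (N.mkQ x) = qB x.2 := fun x => LinearMap.congr_fun hv x
    refine ⟨ModuleCat.of R (F × G), ModuleCat.of R ((F × G) ⧸ N), e.prod (iB ∘ₗ p), N.mkQ,
      inferInstanceAs (Module.Free R (F × G)), inferInstanceAs (Module.Finite R (F × G)),
      isSES_mkQ hj, A', B', u, v, hA', hB', ?_, ?_, ?_⟩
    · rw [injective_iff_map_eq_zero]
      intro x hx
      obtain ⟨x, rfl⟩ := sA.surj x
      rw [hu'] at hx
      simp only [Submodule.mkQ_apply, Submodule.Quotient.mk_eq_zero] at hx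
      obtain ⟨d, hd⟩ := hx
      have h2 : iB (p d) = 0 := congrArg Prod.snd hd
      rw [map_eq_zero_iff _ sB.inj] at h2
      obtain ⟨a, rfl⟩ := (h.exact d).1 h2
      have h1 : iA a = x := by rw [← he']; exact congrArg Prod.fst hd
      rw [← h1, sA.exact.apply_apply_eq_zero]
    · intro y
      obtain ⟨⟨x, y⟩, rfl⟩ := N.mkQ_surjective y
      rw [hv']
      constructor
      · intro hy
        obtain ⟨b, rfl⟩ := (sB.exact y).1 hy
        obtain ⟨d, rfl⟩ := h.surj b
        refine ⟨qA (x - e d), ?_⟩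
        rw [hu', ← sub_eq_zero, ← map_sub]
        simp only [Submodule.mkQ_apply, Submodule.Quotient.mk_eq_zero]
        exact ⟨-d, by simp⟩
      · rintro ⟨w, hw⟩
        obtain ⟨w, rfl⟩ := sA.surj w
        rw [hu'] at hw
        have := congrArg v hw
        rw [hv', hv'] at this
        rw [← this]; simp
    · intro b
      obtain ⟨y, rfl⟩ := sB.surj b
      exact ⟨N.mkQ (0, y), hv' _⟩
  · rintro D ⟨A, B, i, p, hA, hB, h⟩
    obtain ⟨F, A', iA, qA, _, _, sA, hA'⟩ := hA.left
    obtain ⟨G, B', iB, qB, _, _, sB, hB'⟩ := hB.left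
    -- The usual horseshoe construction on the left, from projectivity of `G`.
    obtain ⟨l, hl⟩ := Module.projective_lifting_property p qB h.surj
    have hl' : ∀ y, p (l y) = qB y := fun x => LinearMap.congr_fun hl x
    let σ : (F × G) →ₗ[R] D := (i ∘ₗ qA).coprod l
    have hσ : ∀ x y, σ (x, y) = i (qA x) + l y := fun x y => by simp [σ]
    have hpσ : ∀ z, p (σ z) = qB z.2 := fun z => by
      rw [← Prod.mk.eta (p := z), hσ]; simp [hl', h.exact.apply_apply_eq_zero]
    have hs : Function.Surjective σ := by
      intro d
      obtain ⟨y, hy⟩ := sB.surj (p d)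
      obtain ⟨a, ha⟩ := (h.exact (d - l y)).1 (by simp [hl', hy])
      obtain ⟨x, rfl⟩ := sA.surj a
      exact ⟨(x, y), by rw [hσ, ha]; simp⟩
    let K := LinearMap.ker σ
    obtain ⟨v, hv⟩ := exists_comp_eq_of_range_le sB.inj (LinearMap.snd R F G ∘ₗ K.subtype) (by
      rintro ⟨z, hz⟩
      apply (sB.exact _).1
      rw [LinearMap.comp_apply, Submodule.subtype_apply, LinearMap.snd_apply, ← hpσ,
        LinearMap.mem_ker.1 hz, map_zero])
    have hv' : ∀ z : K, iB (v z) = z.1.2 := fun x => LinearMap.congr_fun hv x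
    let u : A' →ₗ[R] K := (LinearMap.inl R F G ∘ₗ iA).codRestrict K (fun a => by
      rw [LinearMap.mem_ker]
      simp [hσ, sA.exact.apply_apply_eq_zero])
    have hu' : ∀ a, (u a : F × G) = (iA a, 0) := fun a => rfl
    refine ⟨ModuleCat.of R (F × G), ModuleCat.of R K, K.subtype, σ,
      inferInstanceAs (Module.Free R (F × G)), inferInstanceAs (Module.Finite R (F × G)),
      isSES_ker hs, A', B', u, v, hA', hB', ?_, ?_, ?_⟩
    · intro x y hxy
      exact sA.inj (congrArg (fun z : K => z.1.1) hxy)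
    · intro z
      rw [← sB.inj.eq_iff, map_zero, hv']
      constructor
      · obtain ⟨⟨x, y⟩, hz⟩ := z
        intro hy
        obtain rfl : y = 0 := hy
        rw [LinearMap.mem_ker, hσ, map_zero, add_zero, map_eq_zero_iff _ h.inj] at hz
        obtain ⟨a, rfl⟩ := (sA.exact x).1 hz
        exact ⟨a, rfl⟩
      · rintro ⟨a, rfl⟩
        rfl
    · intro b
      obtain ⟨a, ha⟩ := (h.exact (l (iB b))).1 (by rw [hl', sB.exact.apply_apply_eq_zero])
      obtain ⟨x, rfl⟩ := sA.surj a
      refine ⟨⟨(-x, iB b), ?_⟩, sB.inj (hv' _)⟩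
      rw [LinearMap.mem_ker, hσ, ← ha]
      simp
  · rintro D ⟨A, B, i, p, hA, hB, h⟩
    exact hA.extendsForms.extension h hB.extendsForms

/-- The kernel of a surjection between totally reflexive modules is totally reflexive. -/
theorem kernel {A B C : ModuleCat.{u} R} (hB : IsTotallyReflexive B)
    (hC : IsTotallyReflexive C) {i : A →ₗ[R] B} {p : B →ₗ[R] C} (h : IsSES i p) :
    IsTotallyReflexive A := by
  obtain ⟨G, C', iC, qC, _, _, sC, hC'⟩ := hC.left
  -- `P` is the pullback of `B` and `G` over `C`. It is an extension of `B` by `C'`, hence totally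
  -- reflexive; as `G` is projective, it also splits as `A ⊕ G`, with retraction `r` onto `A`.
  let P := LinearMap.ker (p.coprod (-qC))
  have hP : ∀ w : B × G, w ∈ P ↔ p w.1 = qC w.2 := fun w => by
    simp [P, LinearMap.coprod_apply, ← sub_eq_add_neg, sub_eq_zero]
  have hPt : IsTotallyReflexive (ModuleCat.of R P) := by
    refine hC'.extension hB (D := ModuleCat.of R P)
      (i := (LinearMap.inr R B G ∘ₗ iC).codRestrict P fun c => by
        simp [hP, sC.exact.apply_apply_eq_zero])
      (p := LinearMap.fst R B G ∘ₗ P.subtype)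
      ⟨fun x y hxy => sC.inj (congrArg (fun w : P => w.1.2) hxy), fun w => ?_, fun b => ?_⟩
    · constructor
      · intro hw
        have hw : w.1.1 = 0 := hw
        obtain ⟨c, hc⟩ := (sC.exact w.1.2).1 (by rw [← (hP _).1 w.2, hw, map_zero])
        exact ⟨c, Subtype.ext (Prod.ext hw.symm hc)⟩
      · rintro ⟨c, rfl⟩
        rfl
    · obtain ⟨y, hy⟩ := sC.surj (p b)
      exact ⟨⟨(b, y), (hP _).2 hy.symm⟩, rfl⟩
  obtain ⟨l, hl⟩ := Module.projective_lifting_property p qC h.surj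
  have hl' : ∀ y, p (l y) = qC y := fun x => LinearMap.congr_fun hl x
  obtain ⟨r, hr⟩ := exists_comp_eq_of_range_le h.inj
    ((LinearMap.fst R B G - l ∘ₗ LinearMap.snd R B G) ∘ₗ P.subtype) (fun w => by
      apply (h.exact _).1
      simp [hl', (hP _).1 w.2])
  have hr' : ∀ w : P, i (r w) = w.1.1 - l w.1.2 := fun w => LinearMap.congr_fun hr w
  let s : A →ₗ[R] P := (LinearMap.inl R B G ∘ₗ i).codRestrict P fun a => by
    simp [hP, h.exact.apply_apply_eq_zero]
  have hrs : ∀ a, r (s a) = a := fun a => h.inj (by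
    rw [hr']
    change i a - l 0 = i a
    simp)
  -- Adjoining only `A` to the class suffices: its first cosyzygy and first syzygy turn out to be
  -- extensions of totally reflexive modules, and Ext¹ vanishes on it as a retract of `P`.
  refine isTotallyReflexive_of_coinductive (fun M => IsTotallyReflexive M ∨ M = A) ?_ ?_ ?_ A
    (Or.inr rfl)
  · rintro M (hM | rfl)
    · obtain ⟨F, M', f, g, h1, h2, h3, h4⟩ := hM.right
      exact ⟨F, M', f, g, h1, h2, h3, Or.inl h4⟩
    · obtain ⟨F, B', iB, qB, hF1, hF2, sB, hB'⟩ := hB.right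
      -- The cokernel of `A → F` is an extension of `B'` by `B/A ≅ C`.
      set N := LinearMap.range (iB ∘ₗ i) with hN
      obtain ⟨u, hu⟩ := exists_comp_eq_of_ker_le h.surj (N.mkQ ∘ₗ iB) (by
        intro b hb
        obtain ⟨a, rfl⟩ := (h.exact b).1 hb
        simp only [LinearMap.comp_apply, Submodule.mkQ_apply, Submodule.Quotient.mk_eq_zero]
        exact ⟨a, rfl⟩)
      have hu' : ∀ x, u (p x) = N.mkQ (iB x) := fun x => LinearMap.congr_fun hu x
      obtain ⟨v, hv⟩ := exists_comp_eq_of_ker_le N.mkQ_surjective qB (by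
        intro x hx
        simp only [Submodule.mkQ_apply, Submodule.Quotient.mk_eq_zero] at hx
        obtain ⟨d, rfl⟩ := hx
        simp [sB.exact.apply_apply_eq_zero])
      have hv' : ∀ x, v (N.mkQ x) = qB x := fun x => LinearMap.congr_fun hv x
      refine ⟨F, ModuleCat.of R (F ⧸ N), iB ∘ₗ i, N.mkQ, hF1, hF2,
        isSES_mkQ (sB.inj.comp h.inj), Or.inl
        (hC.extension hB' (i := u) (p := v) ⟨?_, fun y => ?_, fun b => ?_⟩)⟩
      · rw [injective_iff_map_eq_zero]
        intro x hx
        obtain ⟨x, rfl⟩ := h.surj x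
        rw [hu'] at hx
        simp only [Submodule.mkQ_apply, Submodule.Quotient.mk_eq_zero] at hx
        obtain ⟨a, ha⟩ := hx
        rw [← sB.inj ha, h.exact.apply_apply_eq_zero]
      · obtain ⟨y, rfl⟩ := N.mkQ_surjective y
        rw [hv', sB.exact]
        constructor
        · rintro ⟨b, rfl⟩
          exact ⟨p b, hu' b⟩
        · rintro ⟨w, hw⟩
          obtain ⟨w, rfl⟩ := h.surj w
          have := congrArg v hw
          rw [hu', hv', hv'] at this
          rw [← sB.exact, ← this, sB.exact.apply_apply_eq_zero]
      · obtain ⟨y, rfl⟩ := sB.surj b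
        exact ⟨N.mkQ y, hv' _⟩
  · rintro M (hM | rfl)
    · obtain ⟨F, M', f, g, h1, h2, h3, h4⟩ := hM.left
      exact ⟨F, M', f, g, h1, h2, h3, Or.inl h4⟩
    · obtain ⟨F, P', iP, qP, hF1, hF2, sP, hP'⟩ := hPt.left
      have hsurj : Function.Surjective (r ∘ₗ qP) := fun a => by
        obtain ⟨x, hx⟩ := sP.surj (s a)
        exact ⟨x, by rw [LinearMap.comp_apply, hx, hrs]⟩
      -- The kernel of `F → P → A` is an extension of `ker r ≅ G` by `P'`.
      refine ⟨F, ModuleCat.of R (LinearMap.ker (r ∘ₗ qP)), (LinearMap.ker (r ∘ₗ qP)).subtype,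
        r ∘ₗ qP, hF1, hF2, isSES_ker hsurj, Or.inl (hP'.extension (of_free G)
          (i := iP.codRestrict _ fun x => by simp [sP.exact.apply_apply_eq_zero])
          (p := LinearMap.snd R B G ∘ₗ P.subtype ∘ₗ qP ∘ₗ (LinearMap.ker (r ∘ₗ qP)).subtype)
          ⟨fun x y hxy => sP.inj (congrArg Subtype.val hxy), fun y => ?_, fun x => ?_⟩)⟩
      · constructor
        · intro hy
          have hy : (qP y.1).1.2 = 0 := hy
          have h1 := hr' (qP y.1)
          have h2 : r (qP y.1) = 0 := y.2
          rw [h2, hy, map_zero, map_zero, sub_zero] at h1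
          obtain ⟨x, hx⟩ := (sP.exact y.1).1 (Subtype.ext (Prod.ext h1.symm hy))
          exact ⟨x, Subtype.ext hx⟩
        · rintro ⟨x, rfl⟩
          simp [sP.exact.apply_apply_eq_zero]
      · obtain ⟨y, hy⟩ := sP.surj ⟨(l x, x), (hP _).2 (hl' x)⟩
        refine ⟨⟨y, ?_⟩, ?_⟩
        · rw [LinearMap.mem_ker, LinearMap.comp_apply, hy]
          exact h.inj (by rw [hr']; simp)
        · simp [hy]
  · rintro M (hM | rfl)
    · exact hM.extendsForms
    · exact hPt.extendsForms.of_retract s r hrs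

end IsTotallyReflexive

/-- In a complex of totally reflexive modules that vanishes in large degrees and is exact above
degree `n`, the module of cycles in degree `n` is totally reflexive. -/
theorem isTotallyReflexive_ker {T : CochainComplex (ModuleCat.{u} R) ℤ}
    (hT : ∀ i, IsTotallyReflexive (T.X i)) (hb : IsBoundedRight T) (n : ℤ)
    (hex : ∀ i, n < i → T.ExactAt i) :
    IsTotallyReflexive (ModuleCat.of R (LinearMap.ker (T.d n (n + 1)).hom)) := by
  obtain ⟨b, hb⟩ := hb
  obtain ⟨k, hk⟩ : ∃ k : ℕ, b ≤ n + k := ⟨(b - n).toNat, by lia⟩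
  induction k generalizing n with
  -- The induction runs over the distance from `n` to the bound `b`. Here the outgoing differential
  -- vanishes; in the other case exactness makes the cycles in degree `n` the kernel of a surjection
  -- onto the cycles in degree `n + 1`.
  | zero =>
    have hn : b ≤ n := by simpa using hk
    have : (T.d n (n + 1)).hom = 0 := by
      rw [(T.isZero_of_isStrictlyLE b (n + 1)).eq_of_tgt (T.d n (n + 1)) 0]; rfl
    refine (hT n).of_equiv (LinearEquiv.symm ?_)
    rw [this]
    exact (LinearEquiv.ofEq _ _ LinearMap.ker_zero).trans Submodule.topEquiv
  | succ k ih =>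
    replace ih := ih (n + 1) (fun i hi => hex i (by lia)) (by push_cast at hk ⊢; lia)
    have hx := (T.exactAt_iff' n (n + 1) (n + 1 + 1) (by simp) (by simp)).1 (hex (n + 1) (by lia))
    replace hx : Function.Exact (T.d n (n + 1)).hom (T.d (n + 1) (n + 1 + 1)).hom :=
      (ShortComplex.ShortExact.moduleCat_exact_iff_function_exact _).1 hx
    let q : T.X n →ₗ[R] LinearMap.ker (T.d (n + 1) (n + 1 + 1)).hom :=
      (T.d n (n + 1)).hom.codRestrict _ fun x => hx.apply_apply_eq_zero x
    refine (hT n).kernel ih (i := (LinearMap.ker (T.d n (n + 1)).hom).subtype) (p := q)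
      ⟨Subtype.val_injective, fun y => ?_, fun y => ?_⟩
    · rw [← Subtype.val_injective.eq_iff]
      change (T.d n (n + 1)).hom y = 0 ↔ _
      simp
    · obtain ⟨x, hx⟩ := (hx y.1).1 y.2
      exact ⟨x, Subtype.ext hx⟩

end GDim

/-! ### Tor-independence from modules of finite projective dimension -/

namespace GDim

open TensorProduct

variable {R : Type u} [CommRing R]

/-- `N` has finite projective dimension. -/
def FinProjDim (R : Type u) [CommRing R] (N : Type u) [AddCommGroup N] [Module R N] : Prop :=
  ∃ n : ℕ, HasProjectiveDimensionLT (ModuleCat.of R N) n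

lemma IsSES.shortExact {A B C : Type u} [AddCommGroup A] [Module R A] [AddCommGroup B]
    [Module R B] [AddCommGroup C] [Module R C] {f : A →ₗ[R] B} {g : B →ₗ[R] C} (h : IsSES f g) :
    (ShortComplex.mk (ModuleCat.ofHom f) (ModuleCat.ofHom g) (by
      ext x; simp [h.exact.apply_apply_eq_zero])).ShortExact :=
  ModuleCat.shortComplex_shortExact _ h.exact h.inj h.surj

lemma IsSES.hasProjectiveDimensionLT {A B C : Type u} [AddCommGroup A] [Module R A]
    [AddCommGroup B] [Module R B] [AddCommGroup C] [Module R C] {f : A →ₗ[R] B} {g : B →ₗ[R] C}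
    (h : IsSES f g) [Module.Projective R B] {n : ℕ}
    (hC : HasProjectiveDimensionLT (ModuleCat.of R C) (n + 2)) :
    HasProjectiveDimensionLT (ModuleCat.of R A) (n + 1) := by
  have : Projective (ModuleCat.of R B) := (IsProjective.iff_projective (R := R) B).1 inferInstance
  exact (h.shortExact.hasProjectiveDimensionLT_X₃_iff n this).1 hC

lemma IsSES.finProjDim {A B C : Type u} [AddCommGroup A] [Module R A]
    [AddCommGroup B] [Module R B] [AddCommGroup C] [Module R C] {f : A →ₗ[R] B} {g : B →ₗ[R] C}
    (h : IsSES f g) [Module.Projective R B] (hC : FinProjDim R C) : FinProjDim R A := by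
  obtain ⟨n, hn⟩ := hC
  exact ⟨n + 1, h.hasProjectiveDimensionLT
    (hasProjectiveDimensionLT_of_ge (ModuleCat.of R C) n (n + 2) (by lia))⟩

/-- `L` is Tor-independent of all modules of finite projective dimension. -/
def TorIndependent (R : Type u) [CommRing R] (L : Type u) [AddCommGroup L] [Module R L] : Prop :=
  ∀ (A B C : Type u) [AddCommGroup A] [Module R A] [AddCommGroup B] [Module R B]
    [AddCommGroup C] [Module R C] (f : A →ₗ[R] B) (g : B →ₗ[R] C), IsSES f g →
    Module.Projective R B → FinProjDim R C → Function.Injective (f.lTensor L)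

lemma TorIndependent.of_flat (L : Type u) [AddCommGroup L] [Module R L] [Module.Flat R L] :
    TorIndependent R L :=
  fun _ _ _ _ _ _ _ _ _ _ _ h _ _ => Module.Flat.lTensor_preserves_injective_linearMap _ h.inj

lemma rTensor_lTensor_apply {A B C D : Type*} [AddCommGroup A] [Module R A] [AddCommGroup B]
    [Module R B] [AddCommGroup C] [Module R C] [AddCommGroup D] [Module R D] (f : A →ₗ[R] B)
    (g : C →ₗ[R] D) (x : A ⊗[R] C) :
    f.rTensor D (g.lTensor A x) = g.lTensor B (f.rTensor C x) := by
  rw [← LinearMap.comp_apply, ← LinearMap.comp_apply, LinearMap.rTensor_comp_lTensor,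
    LinearMap.lTensor_comp_rTensor]

/-- Stated for an identity that is a sum of two factorizations, the form in which the terms of a
mapping cone are given. -/
lemma TorIndependent.of_decomp {L L₁ L₂ : Type u} [AddCommGroup L] [Module R L]
    [AddCommGroup L₁] [Module R L₁] [AddCommGroup L₂] [Module R L₂]
    (h₁ : TorIndependent R L₁) (h₂ : TorIndependent R L₂) (a₁ : L →ₗ[R] L₁) (b₁ : L₁ →ₗ[R] L)
    (a₂ : L →ₗ[R] L₂) (b₂ : L₂ →ₗ[R] L) (h : b₁ ∘ₗ a₁ + b₂ ∘ₗ a₂ = LinearMap.id) :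
    TorIndependent R L := by
  intro A B C _ _ _ _ _ _ f g hfg hB hC
  rw [injective_iff_map_eq_zero]
  intro z hz
  have e₁ : a₁.rTensor A z = 0 := h₁ A B C f g hfg hB hC (by
    rw [← rTensor_lTensor_apply, hz, map_zero, map_zero])
  have e₂ : a₂.rTensor A z = 0 := h₂ A B C f g hfg hB hC (by
    rw [← rTensor_lTensor_apply, hz, map_zero, map_zero])
  have : z = (b₁ ∘ₗ a₁ + b₂ ∘ₗ a₂).rTensor A z := by rw [h, LinearMap.rTensor_id]; rfl
  rw [this, LinearMap.rTensor_add, LinearMap.add_apply, LinearMap.rTensor_comp_apply,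
    LinearMap.rTensor_comp_apply, e₁, e₂, map_zero, map_zero, add_zero]

lemma TorIndependent.of_equiv {L L' : Type u} [AddCommGroup L] [Module R L]
    [AddCommGroup L'] [Module R L'] (h : TorIndependent R L) (e : L ≃ₗ[R] L') :
    TorIndependent R L' :=
  h.of_decomp h e.symm.toLinearMap e.toLinearMap 0 0 (by ext; simp)

/-- An exact sequence of modules that are Tor-independent of the modules of finite projective
dimension stays exact after tensoring with a module of finite projective dimension. -/
theorem exact_rTensor_of_torIndependent {ι : Type*} {r : ι → ι → Prop} (hr : ∀ i, ∃ j, r i j)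
    {L : ι → Type u} [∀ i, AddCommGroup (L i)] [∀ i, Module R (L i)]
    (d : ∀ i j, L i →ₗ[R] L j) (hd : ∀ i j k, r i j → r j k → Function.Exact (d i j) (d j k))
    (hL : ∀ i, TorIndependent R (L i)) (N : Type u) [AddCommGroup N] [Module R N]
    (hN : FinProjDim R N) (i j k : ι) (hij : r i j) (hjk : r j k) :
    Function.Exact ((d i j).rTensor N) ((d j k).rTensor N) := by
  obtain ⟨n, hn⟩ := hN
  replace hn : HasProjectiveDimensionLT (ModuleCat.of R N) (n + 1) :=
    hasProjectiveDimensionLT_of_ge _ n _ (by lia)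
  induction n generalizing N i j k with
  | zero =>
    have : Projective (ModuleCat.of R N) := projective_iff_hasProjectiveDimensionLT_one.2 hn
    have : Module.Projective R N := (IsProjective.iff_projective (R := R) N).2 this
    exact Module.Flat.rTensor_exact N (hd i j k hij hjk)
  | succ n ih =>
    obtain ⟨A, B, f, g, _, hses⟩ : ∃ (A B : ModuleCat.{u} R) (f : A →ₗ[R] B) (g : B →ₗ[R] N),
        Module.Projective R B ∧ IsSES f g :=
      ⟨.of R _, .of R (N →₀ R), _, _, inferInstanceAs (Module.Projective R (N →₀ R)),
        isSES_ker (Finsupp.linearCombination_surjective R Function.surjective_id)⟩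
    have hK := hses.hasProjectiveDimensionLT hn
    intro y
    constructor
    · intro hy
      -- Dimension shifting: exactness at `j` for `N` comes from exactness at `k` for the kernel
      -- `A`, whose projective dimension is smaller. This is why the sequence must continue
      -- indefinitely.
      obtain ⟨l, hkl⟩ := hr k
      obtain ⟨w, rfl⟩ := LinearMap.lTensor_surjective (L j) hses.surj y
      rw [rTensor_lTensor_apply] at hy
      obtain ⟨κ, hκ⟩ := (lTensor_exact (L k) hses.exact hses.surj _).1 hy
      have h0 : (d k l).rTensor _ κ = 0 := by
        apply hL l _ _ _ f g hses inferInstance ⟨_, hn⟩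
        rw [← rTensor_lTensor_apply, hκ, map_zero]
        exact (Module.Flat.rTensor_exact B (hd j k l hjk hkl)).apply_apply_eq_zero w
      obtain ⟨κ', rfl⟩ := (ih _ j k l hjk hkl hK _).1 h0
      rw [← rTensor_lTensor_apply] at hκ
      obtain ⟨v, hv⟩ := (Module.Flat.rTensor_exact B (hd i j k hij hjk)
        (w - f.lTensor (L j) κ')).1 (by rw [map_sub, hκ, sub_self])
      refine ⟨g.lTensor (L i) v, ?_⟩
      rw [rTensor_lTensor_apply, hv, map_sub,
        (lTensor_exact (L j) hses.exact hses.surj).apply_apply_eq_zero, sub_zero]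
    · rintro ⟨x, rfl⟩
      rw [← LinearMap.rTensor_comp_apply, (hd i j k hij hjk).linearMap_comp_eq_zero]
      simp

/-- Acyclic complexes of Tor-independent modules stay acyclic after tensoring
with a module of finite projective dimension. -/
theorem exact_rTensor_complex {F : CochainComplex (ModuleCat.{u} R) ℤ} (hF : F.Acyclic)
    (hL : ∀ i, TorIndependent R (F.X i)) {N : Type u} [AddCommGroup N] [Module R N]
    (hN : FinProjDim R N) (i j k : ℤ) (hij : i + 1 = j) (hjk : j + 1 = k) :
    Function.Exact ((F.d i j).hom.rTensor N) ((F.d j k).hom.rTensor N) :=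
  exact_rTensor_of_torIndependent (r := fun i j => i + 1 = j) (fun _ => ⟨_, rfl⟩)
    (L := fun i => F.X i) (fun i j => (F.d i j).hom) (acyclic_iff_exact.1 hF) hL N hN i j k hij hjk

/-- Images of complete resolutions are compatible with tensoring. -/
lemma rTensor_range_subtype_injective {F : CochainComplex (ModuleCat.{u} R) ℤ} (hF : F.Acyclic)
    (hL : ∀ i, TorIndependent R (F.X i)) {N : Type u} [AddCommGroup N] [Module R N]
    (hN : FinProjDim R N) (i j : ℤ) (hij : i + 1 = j) :
    Function.Injective ((LinearMap.range (F.d i j).hom).subtype.rTensor N) := by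
  rw [injective_iff_map_eq_zero]
  intro z hz
  obtain ⟨w, rfl⟩ := LinearMap.rTensor_surjective N (F.d i j).hom.surjective_rangeRestrict z
  replace hz : (F.d i j).hom.rTensor N w = 0 := by rwa [← LinearMap.rTensor_comp_apply] at hz
  obtain ⟨v, rfl⟩ := (exact_rTensor_complex hF hL hN (i - 1) i j (by simp) hij w).1 hz
  have : (F.d i j).hom.rangeRestrict ∘ₗ (F.d (i - 1) i).hom = 0 := by
    ext x
    simpa using ((acyclic_iff_exact.1 hF) (i - 1) i j (by simp) hij).apply_apply_eq_zero x
  rw [← LinearMap.rTensor_comp_apply, this]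
  simp

/-- `M` embeds in the free module `F.X 1`. Since `A` also has finite projective dimension, `M ⊗ A →
F.X 1 ⊗ A` is injective; following it by the injection into `F.X 1 ⊗ B` gives a map that factors
through `M ⊗ A → M ⊗ B`. -/
lemma IsTotallyReflexive.torIndependent {M : ModuleCat.{u} R} (h : IsTotallyReflexive M) :
    TorIndependent R M := by
  obtain ⟨F, h1, h2, -, ⟨e⟩⟩ := h
  have hflat : ∀ i, Module.Flat R (F.X i) := fun i => by
    have := (h1 i).2
    infer_instance
  refine TorIndependent.of_equiv ?_ e.symm
  intro A B C _ _ _ _ _ _ f g hfg hB hC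
  have i1 := rTensor_range_subtype_injective h2 (fun i => TorIndependent.of_flat (F.X i))
    (hfg.finProjDim hC) 0 1 rfl
  have i2 := Module.Flat.lTensor_preserves_injective_linearMap (M := F.X 1) f hfg.inj
  have := i2.comp i1
  rw [← LinearMap.coe_comp, LinearMap.lTensor_comp_rTensor, ← LinearMap.rTensor_comp_lTensor,
    LinearMap.coe_comp] at this
  exact this.of_comp

/-! ### Base change of totally reflexive modules -/

section BaseChange

variable (S : Type u) [CommRing S] [Algebra R S]

variable (R) in
/-- The extension of scalars `S ⊗ -`. -/
def baseChangeFunctor : ModuleCat.{u} R ⥤ ModuleCat.{u} S where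
  obj M := ModuleCat.of S (S ⊗[R] M)
  map f := ModuleCat.ofHom (f.hom.baseChange S)
  map_id M := by ext : 1; simp
  map_comp f g := by ext : 1; simp [LinearMap.baseChange_comp]

instance : (baseChangeFunctor R S).Additive where
  map_add {M N f g} := by
    ext : 1
    exact LinearMap.baseChange_add _ _

variable {S}

lemma exact_lTensor_of_exact_rTensor {A B C N : Type*} [AddCommGroup A] [Module R A]
    [AddCommGroup B] [Module R B] [AddCommGroup C] [Module R C] [AddCommGroup N] [Module R N]
    {f : A →ₗ[R] B} {g : B →ₗ[R] C} (h : Function.Exact (f.rTensor N) (g.rTensor N)) :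
    Function.Exact (f.lTensor N) (g.lTensor N) := by
  intro y
  obtain ⟨y, rfl⟩ := (TensorProduct.comm R B N).surjective y
  rw [LinearMap.lTensor, LinearMap.lTensor, TensorProduct.map_comm,
    LinearEquiv.map_eq_zero_iff]
  change g.rTensor N y = 0 ↔ _
  rw [h y]
  constructor
  · rintro ⟨x, rfl⟩
    exact ⟨TensorProduct.comm R A N x, by rw [TensorProduct.map_comm]; rfl⟩
  · rintro ⟨x, hx⟩
    obtain ⟨x, rfl⟩ := (TensorProduct.comm R A N).surjective x
    rw [TensorProduct.map_comm] at hx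
    exact ⟨x, (TensorProduct.comm R B N).injective hx⟩

lemma dualTensorHom_rTensor_dualMap {A B N : Type*} [AddCommGroup A] [Module R A]
    [AddCommGroup B] [Module R B] [AddCommGroup N] [Module R N] (f : A →ₗ[R] B)
    (z : Module.Dual R B ⊗[R] N) :
    dualTensorHom R A N (f.dualMap.rTensor N z) = dualTensorHom R B N z ∘ₗ f := by
  induction z with
  | zero => simp
  | tmul φ x => ext; simp
  | add x y hx hy => simp only [map_add, hx, hy, LinearMap.add_comp]

/-- If `Hom(C, R) → Hom(B, R) → Hom(A, R)` is exact and stays exact after tensoring with `S`, then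
so is `Hom(S ⊗ C, S) → Hom(S ⊗ B, S) → Hom(S ⊗ A, S)`. -/
lemma exact_dualMap_baseChange {A B C : Type*} [AddCommGroup A] [Module R A]
    [AddCommGroup B] [Module R B] [AddCommGroup C] [Module R C]
    [Module.Free R A] [Module.Finite R A] [Module.Free R B] [Module.Finite R B]
    {f : A →ₗ[R] B} {g : B →ₗ[R] C} (hgf : g ∘ₗ f = 0)
    (h : Function.Exact (g.dualMap.rTensor S) (f.dualMap.rTensor S)) :
    Function.Exact (g.baseChange S).dualMap (f.baseChange S).dualMap := by
  intro φ
  constructor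
  · intro hφ
    -- For `B` finite free, `Hom_S(S ⊗ B, S) = Hom_R(B, S) = B* ⊗ S`, which turns the question into
    -- the assumed exactness.
    obtain ⟨z, hz⟩ := (dualTensorHomEquiv R B S).surjective
      (φ.restrictScalars R ∘ₗ (TensorProduct.mk R S B 1))
    replace hz : dualTensorHom R B S z = φ.restrictScalars R ∘ₗ (TensorProduct.mk R S B 1) := hz
    obtain ⟨w, rfl⟩ := (h z).1 (by
      apply (dualTensorHomEquiv R A S).injective
      rw [map_zero]
      change dualTensorHom R A S _ = 0
      rw [dualTensorHom_rTensor_dualMap, hz]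
      ext x
      simpa using LinearMap.congr_fun hφ (1 ⊗ₜ x))
    rw [dualTensorHom_rTensor_dualMap] at hz
    refine ⟨(dualTensorHom R C S w).liftBaseChange S, ?_⟩
    ext x
    simpa using LinearMap.congr_fun hz x
  · rintro ⟨ψ, rfl⟩
    rw [LinearMap.dualMap_apply', LinearMap.dualMap_apply', LinearMap.comp_assoc,
      ← LinearMap.baseChange_comp, hgf]
    simp

/-- Base change of totally reflexive modules along `R → S` with `S` of finite projective dimension
over `R`. -/
theorem IsTotallyReflexive.baseChange (hS : FinProjDim R S) {M : ModuleCat.{u} R}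
    (h : IsTotallyReflexive M) : IsTotallyReflexive ((baseChangeFunctor R S).obj M) := by
  obtain ⟨F, h1, h2, h3, ⟨e⟩⟩ := h
  have hfree := fun i => (h1 i).2
  have hfin := fun i => (h1 i).1
  have hflat : ∀ i, TorIndependent R (F.X i) := fun i => by
    have := hfree i
    exact TorIndependent.of_flat _
  refine ⟨((baseChangeFunctor R S).mapHomologicalComplex _).obj F,
    fun i => ⟨inferInstanceAs (Module.Finite S (S ⊗[R] F.X i)),
      inferInstanceAs (Module.Free S (S ⊗[R] F.X i))⟩, ?_, ?_, ?_⟩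
  · rw [acyclic_iff_exact]
    intro i j k hij hjk
    exact exact_lTensor_of_exact_rTensor (exact_rTensor_complex h2 hflat hS i j k hij hjk)
  · intro i
    refine exact_dualMap_baseChange (f := (F.d i (i + 1)).hom) (g := (F.d (i + 1) (i + 2)).hom)
      ?_ ?_
    · rw [← ModuleCat.hom_comp, F.d_comp_d]
      rfl
    -- The dual of the complete resolution is itself an exact complex of free modules, with arrows
    -- running downwards in the index.
    · refine exact_rTensor_of_torIndependent (r := fun i j => j + 1 = i)
        (fun i => ⟨i - 1, by simp⟩) (L := fun i => Module.Dual R (F.X i))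
        (fun i j => (F.d j i).hom.dualMap) ?_ (fun i => TorIndependent.of_flat _) S hS
        (i + 2) (i + 1) i (by ring) rfl
      rintro _ _ k rfl rfl
      have := h3 k
      rwa [show k + 2 = k + 1 + 1 by ring] at this
  · have inj := rTensor_range_subtype_injective h2 hflat hS 0 1 rfl
    have inj' : Function.Injective ((LinearMap.range (F.d 0 1).hom).subtype.baseChange S) := by
      rw [← LinearMap.lTensor_inj_iff_rTensor_inj] at inj
      exact inj
    have key : LinearMap.range ((F.d 0 1).hom.baseChange S) =
        LinearMap.range ((LinearMap.range (F.d 0 1).hom).subtype.baseChange S) := by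
      conv_lhs => rw [show (F.d 0 1).hom = (LinearMap.range (F.d 0 1).hom).subtype ∘ₗ
        (F.d 0 1).hom.rangeRestrict from rfl, LinearMap.baseChange_comp]
      exact LinearMap.range_comp_of_range_eq_top _ (LinearMap.range_eq_top.2
        (LinearMap.lTensor_surjective S (F.d 0 1).hom.surjective_rangeRestrict))
    exact ⟨(e.baseChange R S _ _).trans ((LinearEquiv.ofInjective _ inj').trans
      (LinearEquiv.ofEq _ _ key.symm))⟩

end BaseChange

/-! ### Quasi-isomorphisms and the derived tensor product -/

section QuasiIso

/-- Both conditions can be read in the homotopy category, where quasi-isomorphisms are the morphisms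
whose cone lies in the triangulated subcategory of acyclic complexes. -/
lemma quasiIso_iff_acyclic_mappingCone {C : Type*} [Category C] [Abelian C]
    {K L : CochainComplex C ℤ} (φ : K ⟶ L) :
    QuasiIso φ ↔ (CochainComplex.mappingCone φ).Acyclic := by
  rw [← HomotopyCategory.quotient_obj_mem_subcategoryAcyclic_iff_acyclic,
    ← HomologicalComplex.mem_quasiIso_iff, ← HomotopyCategory.quotient_map_mem_quasiIso_iff,
    HomotopyCategory.quasiIso_eq_trW_subcategoryAcyclic]
  exact (HomotopyCategory.subcategoryAcyclic C).trW_iff_of_distinguished _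
    (HomotopyCategory.mappingCone_triangleh_distinguished φ)

/-- An isomorphism in the derived category whose source is a bounded to the right complex of
projective modules is realized by a quasi-isomorphism. -/
lemma exists_quasiIso {P Q : CochainComplex (ModuleCat.{u} R) ℤ}
    (hP : ∀ i, Module.Projective R (P.X i)) (hb : IsBoundedRight P) (h : DerivedIso P Q) :
    ∃ φ : P ⟶ Q, QuasiIso φ := by
  let := HasDerivedCategory.standard (ModuleCat.{u} R)
  obtain ⟨n, hn⟩ := hb
  have : ∀ i, Projective (P.X i) := fun i =>
    (IsProjective.iff_projective (R := R) (P.X i)).1 (hP i)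
  have : P.IsKProjective := CochainComplex.isKProjective_of_projective P n
  obtain ⟨e⟩ : Nonempty (DerivedCategory.Q.obj P ≅ DerivedCategory.Q.obj Q) := h
  let qi := DerivedCategory.quotientCompQhIso (ModuleCat.{u} R)
  obtain ⟨g, hg⟩ := (CochainComplex.IsKProjective.Qh_map_bijective P
    ((HomotopyCategory.quotient _ _).obj Q)).surjective
    (qi.hom.app P ≫ e.hom ≫ qi.inv.app Q)
  obtain ⟨φ, rfl⟩ := (HomotopyCategory.quotient _ _).map_surjective g
  refine ⟨φ, ?_⟩
  rw [← DerivedCategory.isIso_Q_map_iff_quasiIso]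
  have : IsIso ((HomotopyCategory.quotient _ _ ⋙ DerivedCategory.Qh).map φ) := by
    rw [Functor.comp_map, hg]
    infer_instance
  exact (NatIso.isIso_map_iff qi φ).1 this

/-- The functor `- ⊗ N` preserves quasi-isomorphisms between complexes of Tor-independent modules
if `N` has finite projective dimension. -/
lemma quasiIso_tensorRight {P Q : CochainComplex (ModuleCat.{u} R) ℤ} (φ : P ⟶ Q) [QuasiIso φ]
    (hP : ∀ i, TorIndependent R (P.X i)) (hQ : ∀ i, TorIndependent R (Q.X i))
    (N : Type u) [AddCommGroup N] [Module R N] (hN : FinProjDim R N) :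
    QuasiIso (((MonoidalCategory.tensorRight (ModuleCat.of R N)).mapHomologicalComplex
      (ComplexShape.up ℤ)).map φ) := by
  have hc : (CochainComplex.mappingCone φ).Acyclic := (quasiIso_iff_acyclic_mappingCone φ).1 ‹_›
  rw [quasiIso_iff_acyclic_mappingCone]
  suffices h : (((MonoidalCategory.tensorRight (ModuleCat.of R N)).mapHomologicalComplex
      (ComplexShape.up ℤ)).obj (CochainComplex.mappingCone φ)).Acyclic from
    fun i => (h i).of_iso (CochainComplex.mappingCone.mapHomologicalComplexIso φ
      (MonoidalCategory.tensorRight (ModuleCat.of R N)))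
  rw [acyclic_iff_exact]
  intro i j k hij hjk
  refine exact_rTensor_complex hc (fun i => ?_) hN i j k hij hjk
  have := CochainComplex.mappingCone.id_X φ i (i + 1) rfl
  refine (hP (i + 1)).of_decomp (hQ i) _ _ _ _ (congrArg ModuleCat.Hom.hom this)

end QuasiIso

end GDim

/-! ### Depth and the Cohen–Macaulay case -/

namespace GDim

section Depth

open Abelian

variable {R : Type u} [CommRing R] [IsLocalRing R]

/-- The depth of `M` is at least `n`: `Extⁱ(k, M) = 0` for `i < n`. -/
def DepthGE (R : Type u) [CommRing R] [IsLocalRing R] (n : ℕ) (M : Type u) [AddCommGroup M]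
    [Module R M] : Prop :=
  ∀ i < n, Subsingleton
    (Ext (ModuleCat.of R (IsLocalRing.ResidueField R)) (ModuleCat.of R M) i)

variable {A B C : Type u} [AddCommGroup A] [Module R A] [AddCommGroup B] [Module R B]
  [AddCommGroup C] [Module R C] {f : A →ₗ[R] B} {g : B →ₗ[R] C} {n : ℕ}

lemma DepthGE.mono {m : ℕ} (h : DepthGE R n A) (hmn : m ≤ n) : DepthGE R m A :=
  fun i hi => h i (by lia)

lemma DepthGE.of_subsingleton [Subsingleton A] : DepthGE R n A := by
  intro i _
  have : Limits.IsZero (ModuleCat.of R A) := ModuleCat.isZero_of_subsingleton _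
  exact ⟨fun x y => by
    rw [← Ext.comp_mk₀_id x, ← Ext.comp_mk₀_id y, this.eq_of_src (𝟙 _) 0]
    simp⟩

/-- This and the next two lemmas are the depth inequalities given by the long exact sequence of
Ext(k, -). -/
lemma IsSES.depthGE_left (h : IsSES f g) (hB : DepthGE R (n + 1) B) (hC : DepthGE R n C) :
    DepthGE R (n + 1) A := by
  intro i hi
  refine subsingleton_of_forall_eq 0 fun x => ?_
  have := hB i hi
  cases i with
  | zero =>
    have : Mono (ModuleCat.ofHom f) := h.shortExact.mono_f
    apply Ext.postcomp_mk₀_injective_of_mono _ (ModuleCat.ofHom f)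
    exact Subsingleton.elim _ _
  | succ i =>
    have := hC i (by lia)
    obtain ⟨y, rfl⟩ := Ext.covariant_sequence_exact₁ _ h.shortExact x (Subsingleton.elim _ _)
      (n₀ := i) rfl
    rw [Subsingleton.elim y 0, Ext.zero_comp]

lemma IsSES.depthGE_middle (h : IsSES f g) (hA : DepthGE R n A) (hC : DepthGE R n C) :
    DepthGE R n B := by
  intro i hi
  refine subsingleton_of_forall_eq 0 fun x => ?_
  have := hA i hi
  have := hC i hi
  obtain ⟨y, rfl⟩ := Ext.covariant_sequence_exact₂ _ h.shortExact x (Subsingleton.elim _ _)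
  rw [Subsingleton.elim y 0, Ext.zero_comp]

lemma IsSES.depthGE_right (h : IsSES f g) (hA : DepthGE R (n + 1) A) (hB : DepthGE R n B) :
    DepthGE R n C := by
  intro i hi
  refine subsingleton_of_forall_eq 0 fun x => ?_
  have := hA (i + 1) (by lia)
  have := hB i hi
  obtain ⟨y, rfl⟩ := Ext.covariant_sequence_exact₃ _ h.shortExact x (n₁ := i + 1) rfl
    (Subsingleton.elim _ _)
  rw [Subsingleton.elim y 0, Ext.zero_comp]

lemma DepthGE.of_equiv (h : DepthGE R n A) (e : A ≃ₗ[R] B) : DepthGE R n B := by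
  have hs : IsSES e.toLinearMap (0 : B →ₗ[R] PUnit.{u + 1}) :=
    ⟨e.injective, fun y => ⟨fun _ => e.surjective y, fun _ => rfl⟩, fun _ => ⟨0, rfl⟩⟩
  exact hs.depthGE_middle h DepthGE.of_subsingleton

lemma DepthGE.pi (h : DepthGE R n R) (m : ℕ) : DepthGE R n (Fin m → R) := by
  induction m with
  | zero => exact DepthGE.of_subsingleton
  | succ m ih =>
    refine DepthGE.of_equiv ?_ (Fin.consLinearEquiv R (fun _ : Fin (m + 1) => R))
    exact IsSES.depthGE_middle (f := LinearMap.inl R R (Fin m → R)) (g := LinearMap.snd R R _)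
      ⟨LinearMap.inl_injective, fun y => by
        constructor
        · intro hy
          exact ⟨y.1, Prod.ext rfl (Eq.symm hy)⟩
        · rintro ⟨x, rfl⟩
          rfl, LinearMap.snd_surjective⟩ h ih

lemma DepthGE.of_free (h : DepthGE R n R) [Module.Free R A] [Module.Finite R A] :
    DepthGE R n A :=
  (h.pi _).of_equiv (Module.finBasis R A).equivFun.symm

/-- A totally reflexive module is an `n`-th syzygy for every `n`; each embedding into a free module
gains one unit of depth over the cokernel, up to the depth of `R`. -/
lemma IsTotallyReflexive.depthGE (h : DepthGE R n R) {M : ModuleCat.{u} R}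
    (hM : IsTotallyReflexive M) : DepthGE R n M := by
  induction n generalizing M with
  | zero => exact fun i hi => absurd hi (by lia)
  | succ n ih =>
    obtain ⟨F, M', f, g, _, _, hfg, hM'⟩ := hM.right
    exact hfg.depthGE_left h.of_free (ih (h.mono (by lia)) hM')

/-- A nonzero module of finite length has nonzero socle. Inductively the submodule `N` has none, so
`N = 0` and the module is itself a copy of `k`. -/
lemma subsingleton_of_isFiniteLength {H : Type u} [AddCommGroup H] [Module R H]
    (hH : IsFiniteLength R H) (h : Subsingleton (IsLocalRing.ResidueField R →ₗ[R] H)) :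
    Subsingleton H := by
  induction hH with
  | of_subsingleton => assumption
  | @of_simple_quotient M _ _ N _ hN ih =>
    have hN0 : Subsingleton N := ih ⟨fun a b => by
      have := Subsingleton.elim (N.subtype ∘ₗ a) (N.subtype ∘ₗ b)
      ext x
      exact LinearMap.congr_fun this x⟩
    obtain ⟨I, hI, ⟨e⟩⟩ := isSimpleModule_iff_quot_maximal.1 ‹IsSimpleModule R (M ⧸ N)›
    obtain rfl := IsLocalRing.eq_maximalIdeal hI
    have hb : N = ⊥ := N.subsingleton_iff_eq_bot.1 hN0
    let e' : (IsLocalRing.ResidueField R) ≃ₗ[R] M :=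
      e.symm.trans (N.quotEquivOfEqBot hb)
    have := Subsingleton.elim e'.toLinearMap 0
    have h1 : e' 1 = 0 := LinearMap.congr_fun this 1
    simp at h1

lemma DepthGE.subsingleton_of_isFiniteLength (h : DepthGE R 1 A) (hA : IsFiniteLength R A) :
    Subsingleton A := by
  have := h 0 (by lia)
  have : Subsingleton (ModuleCat.of R (IsLocalRing.ResidueField R) ⟶ ModuleCat.of R A) :=
    Ext.addEquiv₀.symm.subsingleton
  exact GDim.subsingleton_of_isFiniteLength hA
    (ModuleCat.homEquiv (M := ModuleCat.of R (IsLocalRing.ResidueField R))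
      (N := ModuleCat.of R A)).symm.subsingleton

/-- Rees: Ext out of a module supported on the closed point vanishes below the length of a regular
sequence in the maximal ideal. -/
lemma IsCohenMacaulayLocal.depthGE [IsNoetherianRing R] (h : IsCohenMacaulayLocal R) :
    ∃ d : ℕ, ringKrullDim R = (d : WithBot ℕ∞) ∧ DepthGE R d R := by
  obtain ⟨rs, hmem, hreg, hlen⟩ := h
  refine ⟨rs.length, hlen.symm, ?_⟩
  refine ModuleCat.subsingleton_ext_of_exists_isRegular (IsLocalRing.maximalIdeal R)
    (ModuleCat.of R (IsLocalRing.ResidueField R)) ?_ (ModuleCat.of R R) ?_ rs hmem hreg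
  · rw [Module.support_eq_zeroLocus]
    exact PrimeSpectrum.zeroLocus_anti_mono (by
      change _ ≤ Module.annihilator R (R ⧸ IsLocalRing.maximalIdeal R)
      rw [Ideal.annihilator_quotient])
  · rw [lt_top_iff_ne_top]
    change IsLocalRing.maximalIdeal R • (⊤ : Submodule R R) ≠ ⊤
    simp [Ideal.IsPrime.ne_top']

end Depth

section Homology

variable {R : Type u} [CommRing R]

/-- The homology as the quotient of the cycles by the boundaries. -/
lemma isFiniteLength_quotient_range {G : CochainComplex (ModuleCat.{u} R) ℤ} {i j k : ℤ}
    (hij : i + 1 = j) (hjk : j + 1 = k) (h : IsFiniteLength R (G.homology j)) :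
    ∃ q : LinearMap.range (G.d i j).hom →ₗ[R] LinearMap.ker (G.d j k).hom,
      (∀ x, (q x : G.X j) = x) ∧
      IsFiniteLength R (LinearMap.ker (G.d j k).hom ⧸ LinearMap.range q) := by
  let e := ShortComplex.homologyMapIso (G.isoSc' i j k (by simp [← hij]) (by simp [← hjk])) ≪≫
    (G.sc' i j k).moduleCatHomologyIso
  have h0 : ∀ x, (G.d i j).hom x ∈ LinearMap.ker (G.d j k).hom := fun x => by
    rw [LinearMap.mem_ker, ← ModuleCat.comp_apply, G.d_comp_d]
    rfl
  have h2 : IsFiniteLength R (LinearMap.ker (G.d j k).hom ⧸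
      LinearMap.range ((G.d i j).hom.codRestrict (LinearMap.ker (G.d j k).hom) h0)) :=
    e.toLinearEquiv.isFiniteLength h
  have hle : LinearMap.range (G.d i j).hom ≤ LinearMap.ker (G.d j k).hom := by
    rintro _ ⟨x, rfl⟩
    exact h0 x
  refine ⟨Submodule.inclusion hle, fun x => rfl, ?_⟩
  refine LinearEquiv.isFiniteLength (Submodule.quotEquivOfEq _ _ (Submodule.ext fun x => ?_)) h2
  constructor
  · rintro ⟨y, rfl⟩
    exact ⟨⟨_, y, rfl⟩, rfl⟩
  · rintro ⟨⟨_, y, rfl⟩, rfl⟩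
    exact ⟨y, rfl⟩

end Homology

/-- The new intersection property for totally reflexive complexes over Cohen-Macaulay rings. -/
theorem IsCohenMacaulayLocal.newIntersection {R : Type u} [CommRing R] [IsNoetherianRing R]
    [IsLocalRing R] (h : IsCohenMacaulayLocal R) : TotallyReflexiveNewIntersection R := by
  obtain ⟨d, hd, hR⟩ := h.depthGE
  intro s G hGE hLE hG hfl hna
  rw [hd]
  by_contra! hlt
  replace hlt : s < d := by exact_mod_cast hlt
  apply hna
  -- The homology is cycles modulo boundaries. The cycles have depth at least 1 as a submodule of
  -- `G.X j`, so boundaries of depth at least 2 give homology of depth at least 1, which has finite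
  -- length and hence is zero.
  have exact_of_depth : ∀ j : ℤ, DepthGE R 2 (LinearMap.range (G.d (j - 1) j).hom) →
      Function.Exact (G.d (j - 1) j).hom (G.d j (j + 1)).hom := by
    intro j hj
    obtain ⟨q, hq, hlen⟩ := isFiniteLength_quotient_range (i := j - 1) (by simp) rfl (hfl j)
    have hZ : DepthGE R 1 (LinearMap.ker (G.d j (j + 1)).hom) :=
      (isSES_mkQ (Submodule.subtype_injective (LinearMap.ker (G.d j (j + 1)).hom))).depthGE_left
        (((hG j).depthGE hR).mono (by lia)) (fun i hi => absurd hi (by lia))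
    have hqi : Function.Injective q := fun x y hxy => Subtype.ext (by rw [← hq, ← hq, hxy])
    have hH := ((isSES_mkQ hqi).depthGE_right hj hZ).subsingleton_of_isFiniteLength hlen
    rw [Submodule.Quotient.subsingleton_iff, LinearMap.range_eq_top] at hH
    intro y
    constructor
    · intro hy
      obtain ⟨x, hx⟩ := hH ⟨y, hy⟩
      obtain ⟨w, hw⟩ := x.2
      exact ⟨w, by rw [hw, ← hq, hx]⟩
    · rintro ⟨x, rfl⟩
      rw [← ModuleCat.comp_apply, G.d_comp_d]
      rfl
  -- Depth is lost one unit per step from the left end, where the boundaries are zero. Since `t ≤ s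
  -- < d`, the bound `d + 1 - t` stays at least 2.
  have key : ∀ t : ℕ, t ≤ s →
      DepthGE R (d + 1 - t) (LinearMap.range (G.d (-(s : ℤ) + t - 1) (-(s : ℤ) + t)).hom) := by
    intro t
    induction t with
    | zero =>
      intro _
      have : Subsingleton (LinearMap.range (G.d (-(s : ℤ) + (0 : ℕ) - 1) (-(s : ℤ) + (0 : ℕ))).hom) := by
        have : (G.d (-(s : ℤ) + (0 : ℕ) - 1) (-(s : ℤ) + (0 : ℕ))).hom = 0 := by
          rw [(G.isZero_of_isStrictlyGE (-(s : ℤ)) (-(s : ℤ) + (0 : ℕ) - 1)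
            (by simp)).eq_of_src (G.d _ _) 0]
          rfl
        rw [this, LinearMap.range_zero]
        infer_instance
      exact DepthGE.of_subsingleton
    | succ t ih =>
      intro ht
      have h1 := ih (by lia)
      have h2 := exact_of_depth _ (h1.mono (by lia))
      have h3 := (isSES_range h2).depthGE_right (n := d - t) (h1.mono (by lia))
        (((hG _).depthGE hR).mono (by lia))
      rw [show d + 1 - (t + 1) = d - t by lia]
      have e1 : -(s : ℤ) + ((t + 1 : ℕ) : ℤ) - 1 = -(s : ℤ) + t := by push_cast; ring
      have e2 : -(s : ℤ) + ((t + 1 : ℕ) : ℤ) = -(s : ℤ) + t + 1 := by push_cast; ring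
      rw [e1, e2]
      exact h3
  intro j
  by_cases hj : 0 < j
  · exact HomologicalComplex.ExactAt.of_isZero (G.isZero_of_isStrictlyLE 0 j)
  by_cases hj' : j < -(s : ℤ)
  · exact HomologicalComplex.ExactAt.of_isZero (G.isZero_of_isStrictlyGE (-(s : ℤ)) j)
  obtain ⟨t, ht⟩ : ∃ t : ℕ, j = -(s : ℤ) + t := ⟨(j + s).toNat, by lia⟩
  rw [G.exactAt_iff' (j - 1) j (j + 1) (by simp) (by simp)]
  refine (ShortComplex.ShortExact.moduleCat_exact_iff_function_exact _).2 (exact_of_depth j ?_)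
  subst ht
  exact (key t (by lia)).mono (by lia)

end GDim

/-! ### Support, finite length and localization of homology -/

namespace GDim

open TensorProduct

section Support

variable {R : Type u} [CommRing R]

/-- The maximal ideal is minimal over the annihilator, so `H` is a finite module over the Artinian
ring `R / Ann H`. -/
lemma isFiniteLength_of_support_subset [IsNoetherianRing R] [IsLocalRing R] (H : Type u)
    [AddCommGroup H] [Module R H] [Module.Finite R H]
    (h : Module.support R H ⊆ {IsLocalRing.closedPoint R}) : IsFiniteLength R H := by
  rcases subsingleton_or_nontrivial H with hH | hH
  · exact .of_subsingleton
  rw [isFiniteLength_iff_isNoetherian_isArtinian]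
  refine ⟨inferInstance, ?_⟩
  have hmin : IsLocalRing.maximalIdeal R ∈ (Module.annihilator R H).minimalPrimes := by
    refine ⟨⟨inferInstance, IsLocalRing.le_maximalIdeal ?_⟩, fun p hp _ => ?_⟩
    · rw [Ne, Module.annihilator_eq_top_iff]
      exact not_subsingleton H
    · have hp' : (⟨p, hp.1⟩ : PrimeSpectrum R) ∈ Module.support R H := by
        rw [Module.support_eq_zeroLocus]
        exact hp.2
      exact (congrArg PrimeSpectrum.asIdeal (h hp')).ge
  have := IsLocalRing.quotient_artinian_of_mem_minimalPrimes_of_isLocalRing _ hmin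
  let := Module.quotientAnnihilator (R := R) (M := H)
  have : IsScalarTower R (R ⧸ Module.annihilator R H) H :=
    ⟨fun a b x => by
      obtain ⟨b, rfl⟩ := Ideal.Quotient.mk_surjective b
      exact mul_smul a b x⟩
  have : Module.Finite (R ⧸ Module.annihilator R H) H :=
    Module.Finite.of_restrictScalars_finite R _ _
  exact isArtinian_of_surjective_algebraMap (R := R ⧸ Module.annihilator R H)
    Ideal.Quotient.mk_surjective

lemma isZero_localizedModule_iff (p : PrimeSpectrum R) (M : ModuleCat.{u} R) :
    Limits.IsZero (M.localizedModule p.asIdeal.primeCompl) ↔ p ∉ Module.support R M := by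
  rw [ModuleCat.isZero_iff_subsingleton, Module.notMem_support_iff,
    IsLocalizedModule.subsingleton_iff p.asIdeal.primeCompl
      (M.localizedModuleMkLinearMap p.asIdeal.primeCompl),
    LocalizedModule.subsingleton_iff]

/-- Localization is exact and so commutes with homology. -/
lemma isZero_homology_localize_iff (Y : CochainComplex (ModuleCat.{u} R) ℤ) (p : PrimeSpectrum R)
    (j : ℤ) : Limits.IsZero ((localize Y p).homology j) ↔
      p ∉ Module.support R (Y.homology j) := by
  rw [← isZero_localizedModule_iff]
  exact ((Y.sc j).mapHomologyIso
    (ModuleCat.localizedModuleFunctor.{u} p.asIdeal.primeCompl)).isZero_iff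

lemma mem_supp_iff (Y : CochainComplex (ModuleCat.{u} R) ℤ) (p : PrimeSpectrum R) :
    p ∈ supp Y ↔ ∃ j, p ∈ Module.support R (Y.homology j) := by
  simp only [supp, Set.mem_ofPred_eq, HomologicalComplex.Acyclic,
    HomologicalComplex.exactAt_iff_isZero_homology, isZero_homology_localize_iff]
  push Not
  rfl

lemma finite_homology [IsNoetherianRing R] (Y : CochainComplex (ModuleCat.{u} R) ℤ) (j : ℤ)
    (h : Module.Finite R (Y.X j)) : Module.Finite R (Y.homology j) := by
  have : Module.Finite R (Y.sc j).X₂ := h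
  have : Module.Finite R (Y.sc j).moduleCatLeftHomologyData.H :=
    inferInstanceAs (Module.Finite R (LinearMap.ker (Y.sc j).g.hom ⧸
      LinearMap.range (Y.sc j).moduleCatToCycles))
  exact Module.Finite.equiv (Y.sc j).moduleCatHomologyIso.toLinearEquiv.symm

end Support

/-! ### Tensoring with a cyclic module as base change -/

section Cyclic

variable {R : Type u} [CommRing R]

lemma exists_equiv_quotient_annihilator (N : Type*) [AddCommGroup N] [Module R N]
    (hN : (⊤ : Submodule R N).IsPrincipal) :
    Nonempty (N ≃ₗ[R] R ⧸ Module.annihilator R N) := by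
  obtain ⟨x, hx⟩ := hN
  have hs : Function.Surjective (LinearMap.toSpanSingleton R N x) := by
    rw [← LinearMap.range_eq_top, LinearMap.range_toSpanSingleton, hx]
  refine ⟨((Submodule.quotEquivOfEq _ _ ?_).trans
    ((LinearMap.toSpanSingleton R N x).quotKerEquivOfSurjective hs)).symm⟩
  ext r
  rw [Module.mem_annihilator, LinearMap.mem_ker]
  constructor
  · intro h
    exact h x
  · intro h y
    obtain ⟨a, rfl⟩ := hs y
    rw [← map_smul, smul_eq_mul, mul_comm, ← smul_eq_mul, map_smul, h, smul_zero]

lemma FinProjDim.of_equiv {N N' : Type u} [AddCommGroup N] [Module R N] [AddCommGroup N']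
    [Module R N'] (h : FinProjDim R N) (e : N ≃ₗ[R] N') : FinProjDim R N' := by
  obtain ⟨n, hn⟩ := h
  exact ⟨n, hasProjectiveDimensionLT_of_iso e.toModuleIso n⟩

lemma finProjDim_of_projectiveDimension_lt_top {N : Type u} [AddCommGroup N] [Module R N]
    (h : projectiveDimension (ModuleCat.of R N) < ⊤) : FinProjDim R N := by
  obtain ⟨n, hn⟩ := (projectiveDimension_ne_top_iff _).1 h.ne
  exact ⟨n + 1, hn⟩

variable {S : Type u} [CommRing S] [Algebra R S]

/-- If `N ≅ S` then `M ⊗ N` is the underlying `R`-module of `S ⊗ M`. -/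
def tensorEquivRestrictScalars {N : Type u} [AddCommGroup N] [Module R N] (e : N ≃ₗ[R] S)
    (M : ModuleCat.{u} R) :
    (M ⊗[R] N) ≃ₗ[R]
      (ModuleCat.restrictScalars (algebraMap R S)).obj ((baseChangeFunctor R S).obj M) :=
  { ((TensorProduct.comm R M N).trans
      (TensorProduct.congr e (LinearEquiv.refl R M))).toAddEquiv with
    map_smul' := fun r x => by
      refine (map_smul ((TensorProduct.comm R M N).trans
        (TensorProduct.congr e (LinearEquiv.refl R M))) r x).trans ?_
      exact (algebraMap_smul S r (_ : S ⊗[R] M)).symm }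

/-- If `N ≅ S` then `- ⊗ N` is the base change to `S` followed by restriction of scalars. -/
def tensorRightIso {N : Type u} [AddCommGroup N] [Module R N] (e : N ≃ₗ[R] S) :
    MonoidalCategory.tensorRight (ModuleCat.of R N) ≅
      baseChangeFunctor R S ⋙ ModuleCat.restrictScalars (algebraMap R S) :=
  NatIso.ofComponents (fun M => (tensorEquivRestrictScalars e M).toModuleIso)
    (fun {M M'} f => by
      ext x
      change (TensorProduct.congr e (LinearEquiv.refl R M')) ((TensorProduct.comm R M' N)
          (f.hom.rTensor N x)) =
        f.hom.baseChange S ((TensorProduct.congr e (LinearEquiv.refl R M))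
          (TensorProduct.comm R M N x))
      induction x using TensorProduct.induction_on with
      | zero => simp
      | tmul m n => simp
      | add x y hx hy => simp only [map_add, hx, hy])

/-- The homology of `Q ⊗ N` is that of the base change of `Q` to `S ≅ N`. -/
lemma homologyIso_tensorRight {N : Type u} [AddCommGroup N] [Module R N] (e : N ≃ₗ[R] S)
    (Q : CochainComplex (ModuleCat.{u} R) ℤ) (j : ℤ) :
    Nonempty ((((MonoidalCategory.tensorRight (ModuleCat.of R N)).mapHomologicalComplex
      (ComplexShape.up ℤ)).obj Q).homology j ≅
      (ModuleCat.restrictScalars (algebraMap R S)).obj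
        ((((baseChangeFunctor R S).mapHomologicalComplex (ComplexShape.up ℤ)).obj Q).homology j)) :=
  ⟨HomologicalComplex.homologyMapIso
    ((NatIso.mapHomologicalComplex (tensorRightIso e) (ComplexShape.up ℤ)).app Q) j ≪≫
    ((((baseChangeFunctor R S).mapHomologicalComplex (ComplexShape.up ℤ)).obj Q).sc j).mapHomologyIso
      (ModuleCat.restrictScalars (algebraMap R S))⟩

lemma isFiniteLength_of_restrictScalars (M : ModuleCat.{u} S)
    (h : IsFiniteLength R ((ModuleCat.restrictScalars (algebraMap R S)).obj M)) :
    IsFiniteLength S M := by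
  rw [isFiniteLength_iff_isNoetherian_isArtinian] at h ⊢
  let : Module R M := Module.compHom M (algebraMap R S)
  have : IsScalarTower R S M := ⟨fun r s x => by
    rw [Algebra.smul_def, mul_smul]
    rfl⟩
  exact ⟨@isNoetherian_of_tower R S M _ _ _ _ _ _ _ h.1, @isArtinian_of_tower R S M _ _ _ _ _ _ _ h.2⟩

end Cyclic

/-! ### Truncation of totally reflexive complexes -/

section Truncation

variable {S : Type u} [CommRing S]

/-- The new intersection property for complexes in arbitrary degrees whose homology vanishes to
the right of degree `n`. -/
theorem TotallyReflexiveNewIntersection.ringKrullDim_le (h : TotallyReflexiveNewIntersection S)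
    {T : CochainComplex (ModuleCat.{u} S) ℤ} (hT : ∀ i, IsTotallyReflexive (T.X i))
    (hb : IsBoundedRight T) (hfl : ∀ i, IsFiniteLength S (T.homology i)) (n : ℤ)
    (hn : ¬ T.ExactAt n) (hex : ∀ i, n < i → T.ExactAt i) (s : ℕ)
    (hs : ∀ i, i < n - s → Limits.IsZero (T.X i)) :
    ringKrullDim S ≤ ((s : ℕ) : WithBot ℕ∞) := by
  have hgel : ∀ i, i < n - s → Limits.IsZero ((T.truncLE n).X i) := fun i hi =>
    (hs i hi).of_iso (T.truncLEXIso n i (by lia))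
  have hTR : ∀ i, IsTotallyReflexive ((T.truncLE n).X i) := by
    intro i
    rcases lt_trichotomy i n with hi | rfl | hi
    · exact (hT i).of_equiv (T.truncLEXIso n i hi).symm.toLinearEquiv
    -- Only the edge of the truncation differs from `T`: there the term is the module of cycles, to
    -- which exactness beyond this degree applies.
    · have e : (T.truncLE i).X i ≅ ModuleCat.of S (LinearMap.ker (T.d i (i + 1)).hom) :=
        T.truncLEXIsoCycles i ≪≫ ShortComplex.cyclesMapIso (T.isoSc' (i - 1) i (i + 1)
          (by simp) (by simp)) ≪≫ (T.sc' (i - 1) i (i + 1)).moduleCatCyclesIso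
      exact (isTotallyReflexive_ker hT hb i hex).of_equiv e.symm.toLinearEquiv
    · have hz := (T.truncLE n).isZero_of_isStrictlyLE n i hi
      have := ModuleCat.subsingleton_of_isZero hz
      exact IsTotallyReflexive.of_free _
  have hlen : ∀ i, IsFiniteLength S ((T.truncLE n).homology i) := by
    intro i
    rcases le_or_gt i n with hi | hi
    · have := T.quasiIsoAt_ιTruncLE n i hi
      exact (isoOfQuasiIsoAt (T.ιTruncLE n) i).symm.toLinearEquiv.isFiniteLength (hfl i)
    · have hz := (T.truncLE n).isZero_of_isStrictlyLE n i hi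
      have := ModuleCat.subsingleton_of_isZero
        (HomologicalComplex.ExactAt.of_isZero hz).isZero_homology
      exact .of_subsingleton
  -- The shift moves degree `n` to degree 0, so that `G` lives in degrees `-s` to 0.
  let G := (T.truncLE n)⟦n⟧
  have eG : ∀ i, Nonempty (G.homology i ≅ (T.truncLE n).homology (n + i)) := fun i =>
    ⟨((HomologicalComplex.homologyFunctor (ModuleCat.{u} S) (ComplexShape.up ℤ) 0).shiftIso
      n i (n + i) rfl).app (T.truncLE n)⟩
  refine h s G ?_ ?_ (fun i => hTR (i + n)) (fun i => ?_) fun hac => hn ?_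
  · rw [CochainComplex.isStrictlyGE_iff]
    intro i hi
    exact hgel (i + n) (by lia)
  · exact CochainComplex.isStrictlyLE_shift (T.truncLE n) n n 0 (by simp)
  · obtain ⟨e⟩ := eG i
    exact e.symm.toLinearEquiv.isFiniteLength (hlen _)
  · have h0 := hac 0
    obtain ⟨e⟩ := eG 0
    rw [HomologicalComplex.exactAt_iff_isZero_homology] at h0 ⊢
    have h1 := h0.of_iso e.symm
    rw [add_zero] at h1
    exact h1.of_iso (isoOfQuasiIsoAt (T.ιTruncLE n) n).symm

end Truncation

end GDim

/-! ### Dimensions and suprema as extended real numbers -/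

namespace GDim

section EReal

lemma dimToEReal_mono {a : WithBot ℕ∞} {n : ℕ} (h : a ≤ (n : WithBot ℕ∞)) :
    dimToEReal a ≤ ((n : ℝ) : EReal) := by
  induction a using WithBot.recBotCoe with
  | bot => exact bot_le
  | coe a =>
    have h' : a ≤ (n : ℕ∞) := by exact_mod_cast h
    lift a to ℕ using ne_top_of_le_ne_top (ENat.natCast_ne_top n) h'
    have h'' : a ≤ n := by exact_mod_cast h'
    change ((((a : ℕ∞) : ENNReal)) : EReal) ≤ _
    calc (((a : ℕ∞) : ENNReal) : EReal) ≤ ((n : ENNReal) : EReal) := by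
          rw [ENat.toENNReal_coe, EReal.coe_ennreal_le_coe_ennreal_iff]
          exact_mod_cast h''
      _ = ((n : ℝ) : EReal) := by
          rw [← EReal.coe_ennreal_toReal (ENNReal.natCast_ne_top n), ENNReal.toReal_natCast]

lemma dimToEReal_zero : dimToEReal 0 = 0 := by
  change ((((0 : ℕ∞) : ENNReal)) : EReal) = 0
  simp

end EReal

section Dimension

variable {R : Type u} [CommRing R]

lemma homInf_eq {Y : CochainComplex (ModuleCat.{u} R) ℤ} {n : ℤ}
    (hn : ¬ Limits.IsZero (Y.homology n)) (hmax : ∀ j, n < j → Limits.IsZero (Y.homology j)) :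
    homInf Y = (((-n : ℤ) : ℝ) : EReal) := by
  refine IsLeast.csInf_eq ⟨⟨-n, by simpa using hn, rfl⟩, ?_⟩
  rintro _ ⟨l, hl, rfl⟩
  have : -n ≤ l := by
    by_contra! hlt
    exact hl (hmax _ (by lia))
  exact_mod_cast this

/-- The closed point alone gives the bound: `dim R/m = 0` and the infimum of the localized complex
there is `-n`. -/
lemma le_cdim [IsLocalRing R] {Y : CochainComplex (ModuleCat.{u} R) ℤ} {n : ℤ}
    (hn : IsLocalRing.closedPoint R ∈ Module.support R (Y.homology n))
    (hmax : ∀ j, n < j → Limits.IsZero (Y.homology j)) :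
    ((n : ℝ) : EReal) ≤ cdim Y := by
  refine le_trans (le_of_eq ?_) (le_iSup _ (IsLocalRing.closedPoint R))
  have h1 : homInf (localize Y (IsLocalRing.closedPoint R)) = (((-n : ℤ) : ℝ) : EReal) := by
    refine homInf_eq ?_ fun j hj => ?_
    · rwa [isZero_homology_localize_iff, not_not]
    · have := ModuleCat.subsingleton_of_isZero (hmax j hj)
      rw [isZero_homology_localize_iff, Module.support_eq_empty_iff.2 this]
      exact Set.notMem_empty _
  have h2 : ringKrullDim (R ⧸ (IsLocalRing.closedPoint R).asIdeal) = 0 :=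
    ringKrullDim_eq_zero_of_field (IsLocalRing.ResidueField R)
  rw [h1, h2, dimToEReal_zero]
  simp

/-- If `termSup Q` is finite, it is attained at an integer `g`, and `Q.X n ≠ 0` gives `g ≥ -n`; the
hypothesis is then used with the natural number `s = g + n`. An infinite supremum makes the bound
trivial. -/
lemma le_termSup_add {Q : CochainComplex (ModuleCat.{u} R) ℤ} {n : ℤ}
    (hn : ¬ Limits.IsZero (Q.X n)) {a : EReal}
    (h : ∀ s : ℕ, (∀ i, i < n - s → Limits.IsZero (Q.X i)) → a ≤ ((s : ℝ) : EReal)) :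
    a ≤ termSup Q + ((n : ℝ) : EReal) := by
  by_cases htop : termSup Q = ⊤
  · rw [htop, EReal.top_add_coe]
    exact le_top
  have hle : ∀ l : ℤ, ¬ Limits.IsZero (Q.X (-l)) → ((l : ℝ) : EReal) ≤ termSup Q :=
    fun l hl => le_sSup ⟨l, hl, rfl⟩
  have hbot : termSup Q ≠ ⊥ := ne_bot_of_le_ne_bot (EReal.coe_ne_bot _)
    (hle (-n) (by rwa [neg_neg]))
  obtain ⟨x, hx⟩ : ∃ x : ℝ, termSup Q = x := ⟨_, (EReal.coe_toReal htop hbot).symm⟩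
  rw [hx] at hle ⊢
  obtain ⟨g, hg, hgmax⟩ := Int.exists_greatest_of_bdd
    (P := fun l => ¬ Limits.IsZero (Q.X (-l)))
    ⟨⌊x⌋, fun l hl => Int.le_floor.2 (by exact_mod_cast hle l hl)⟩ ⟨-n, by rwa [neg_neg]⟩
  have hgn : -n ≤ g := hgmax _ (by rwa [neg_neg])
  have hgx : (g : ℝ) ≤ x := by exact_mod_cast hle g hg
  have key := h (g + n).toNat (fun i hi => by
    by_contra hz
    have := hgmax (-i) (by rwa [neg_neg])
    lia)
  refine key.trans ?_
  have h1 : (((g + n).toNat : ℕ) : ℝ) = (g : ℝ) + n := by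
    have : (((g + n).toNat : ℕ) : ℤ) = g + n := Int.toNat_of_nonneg (by lia)
    exact_mod_cast congrArg (Int.cast : ℤ → ℝ) this
  rw [h1, ← EReal.coe_add, EReal.coe_le_coe_iff]
  linarith

end Dimension

section DerivedIso

variable {R : Type u} [CommRing R]

lemma DerivedIso.symm {X Y : CochainComplex (ModuleCat.{u} R) ℤ} (h : DerivedIso X Y) :
    DerivedIso Y X := by
  let := HasDerivedCategory.standard (ModuleCat.{u} R)
  obtain ⟨e⟩ : Nonempty (DerivedCategory.Q.obj X ≅ DerivedCategory.Q.obj Y) := h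
  exact ⟨e.symm⟩

lemma DerivedIso.trans {X Y Z : CochainComplex (ModuleCat.{u} R) ℤ} (h : DerivedIso X Y)
    (h' : DerivedIso Y Z) : DerivedIso X Z := by
  let := HasDerivedCategory.standard (ModuleCat.{u} R)
  obtain ⟨e⟩ : Nonempty (DerivedCategory.Q.obj X ≅ DerivedCategory.Q.obj Y) := h
  obtain ⟨e'⟩ : Nonempty (DerivedCategory.Q.obj Y ≅ DerivedCategory.Q.obj Z) := h'
  exact ⟨e.trans e'⟩

end DerivedIso

/-! ### The inequality for cyclic modules of finite projective dimension -/

section Main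

variable {R : Type u} [CommRing R] [IsNoetherianRing R] [IsLocalRing R]

/-- The bound on `dim N` obtained from one resolution of `X` by totally reflexive modules. -/
theorem supportDim_le_termSup_add {N : Type u} [AddCommGroup N] [Module R N]
    {X : CochainComplex (ModuleCat.{u} R) ℤ} (P : ProjRes X)
    (hcyc : (⊤ : Submodule R N).IsPrincipal) (hpd : FinProjDim R N)
    (hsupp : ∀ j, Module.support R ((P.derivedTensor N).homology j) ⊆
      {IsLocalRing.closedPoint R})
    (hNI : TotallyReflexiveNewIntersection (R ⧸ Module.annihilator R N)) {n : ℤ}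
    (hn : ¬ Limits.IsZero ((P.derivedTensor N).homology n))
    (hmax : ∀ j, n < j → Limits.IsZero ((P.derivedTensor N).homology j))
    {Q : CochainComplex (ModuleCat.{u} R) ℤ} (hQb : IsBoundedRight Q)
    (hQ : ∀ i, IsTotallyReflexive (Q.X i)) (hQX : DerivedIso Q X) :
    dimToEReal (Module.supportDim R N) ≤ termSup Q + ((n : ℝ) : EReal) := by
  obtain ⟨e⟩ := exists_equiv_quotient_annihilator N hcyc
  have : Module.Finite R N := Module.Finite.equiv e.symm
  let T := ((baseChangeFunctor R (R ⧸ Module.annihilator R N)).mapHomologicalComplex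
    (ComplexShape.up ℤ)).obj Q
  have hflat : ∀ i, TorIndependent R (P.complex.X i) := fun i => by
    have := P.projective i
    exact TorIndependent.of_flat _
  obtain ⟨φ, hφ⟩ := exists_quasiIso P.projective P.bounded (P.iso.trans hQX.symm)
  have hqi := quasiIso_tensorRight φ hflat (fun i => (hQ i).torIndependent) N hpd
  let Y := ((MonoidalCategory.tensorRight (ModuleCat.of R N)).mapHomologicalComplex
    (ComplexShape.up ℤ)).obj Q
  have ePY : ∀ j, (P.derivedTensor N).homology j ≅ Y.homology j := fun j =>
    isoOfQuasiIsoAt (((MonoidalCategory.tensorRight (ModuleCat.of R N)).mapHomologicalComplex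
      (ComplexShape.up ℤ)).map φ) j
  have hT : ∀ j, Nonempty (Y.homology j ≅
      (ModuleCat.restrictScalars (algebraMap R (R ⧸ Module.annihilator R N))).obj
        (T.homology j)) := homologyIso_tensorRight e Q
  have hzero : ∀ j, Limits.IsZero ((P.derivedTensor N).homology j) ↔ T.ExactAt j := fun j => by
    obtain ⟨e'⟩ := hT j
    rw [HomologicalComplex.exactAt_iff_isZero_homology, (ePY j ≪≫ e').isZero_iff,
      ModuleCat.isZero_iff_subsingleton, ModuleCat.isZero_iff_subsingleton]
    rfl
  -- Finiteness is taken from `Q`, whose terms are finitely generated; those of the projective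
  -- resolution need not be.
  have hfin : ∀ j, Module.Finite R (Y.homology j) := fun j => by
    have := (hQ j).finite
    exact finite_homology Y j (inferInstanceAs (Module.Finite R (TensorProduct R (Q.X j) N)))
  have hlen : ∀ j, IsFiniteLength (R ⧸ Module.annihilator R N) (T.homology j) := fun j => by
    obtain ⟨e'⟩ := hT j
    apply isFiniteLength_of_restrictScalars (R := R)
    apply e'.toLinearEquiv.isFiniteLength
    have := hfin j
    apply isFiniteLength_of_support_subset
    rw [← (ePY j).toLinearEquiv.support_eq]
    exact hsupp j
  have hTb : IsBoundedRight T := by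
    obtain ⟨b, hb⟩ := hQb
    refine ⟨b, ?_⟩
    rw [CochainComplex.isStrictlyLE_iff] at hb ⊢
    exact fun i hi => (baseChangeFunctor R _).map_isZero (hb i hi)
  refine le_termSup_add (fun hz => hn ?_) fun s hs => dimToEReal_mono ?_
  · rw [hzero]
    exact .of_isZero ((baseChangeFunctor R _).map_isZero hz)
  · rw [Module.supportDim_eq_ringKrullDim_quotient_annihilator]
    exact hNI.ringKrullDim_le (T := T) (fun i => (hQ i).baseChange (hpd.of_equiv e)) hTb hlen n
      (by rwa [← hzero]) (fun i hi => by rw [← hzero]; exact hmax i hi) s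
      (fun i hi => (baseChangeFunctor R _).map_isZero (hs i hi))

/-- The degree `n` of the last nonzero homology depends only on `P ⊗ N` and not on `Q`. Being
finite, it can be subtracted, so the bounds for the individual `Q` pass to the infimum. -/
theorem supportDim_le_gdim_add_cdim {N : Type u} [AddCommGroup N] [Module R N]
    {X : CochainComplex (ModuleCat.{u} R) ℤ} (P : ProjRes X)
    (hcyc : (⊤ : Submodule R N).IsPrincipal) (hpd : FinProjDim R N)
    (hsupp : supp (P.derivedTensor N) = {IsLocalRing.closedPoint R})
    (hNI : TotallyReflexiveNewIntersection (R ⧸ Module.annihilator R N)) :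
    dimToEReal (Module.supportDim R N) ≤ gdim X + cdim (P.derivedTensor N) := by
  have hsub : ∀ j, Module.support R ((P.derivedTensor N).homology j) ⊆
      {IsLocalRing.closedPoint R} := fun j p hp => by
    rw [← hsupp, mem_supp_iff]
    exact ⟨j, hp⟩
  obtain ⟨j, hj⟩ := (mem_supp_iff (P.derivedTensor N) (IsLocalRing.closedPoint R)).1
    (by rw [hsupp]; rfl)
  have hmem : ∀ j, ¬ Limits.IsZero ((P.derivedTensor N).homology j) ↔
      IsLocalRing.closedPoint R ∈ Module.support R ((P.derivedTensor N).homology j) := fun j => by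
    rw [ModuleCat.isZero_iff_subsingleton, ← Module.support_eq_empty_iff (R := R),
      ← Ne, ← Set.nonempty_iff_ne_empty]
    constructor
    · rintro ⟨p, hp⟩
      obtain rfl := hsub j hp
      exact hp
    · exact fun h => ⟨_, h⟩
  obtain ⟨b, hb⟩ := P.bounded
  have hzero : ∀ j, b < j → Limits.IsZero ((P.derivedTensor N).homology j) := fun j hj =>
    (HomologicalComplex.ExactAt.of_isZero (K := P.derivedTensor N)
      ((MonoidalCategory.tensorRight (ModuleCat.of R N)).map_isZero
        (P.complex.isZero_of_isStrictlyLE b j hj))).isZero_homology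
  obtain ⟨n, hn, hmax⟩ := Int.exists_greatest_of_bdd
    (P := fun l => ¬ Limits.IsZero ((P.derivedTensor N).homology l))
    ⟨b, fun l hl => by
      by_contra! hlt
      exact hl (hzero l hlt)⟩ ⟨j, (hmem j).2 hj⟩
  have hmax' : ∀ j, n < j → Limits.IsZero ((P.derivedTensor N).homology j) := fun j hj => by
    by_contra hz
    exact absurd (hmax j hz) (by lia)
  refine le_trans ?_ (add_le_add_right (le_cdim ((hmem n).1 hn) hmax') (gdim X))
  refine (EReal.sub_le_iff_le_add (.inl (EReal.coe_ne_bot _)) (.inl (EReal.coe_ne_top _))).1 ?_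
  refine le_sInf ?_
  rintro _ ⟨Q, hQb, hQ, hQX, rfl⟩
  exact EReal.sub_le_of_le_add
    (supportDim_le_termSup_add P hcyc hpd hsub hNI hn hmax' hQb hQ hQX)

end Main

end GDim

end

theorem theorem4p1 (R : Type u) [CommRing R] [IsNoetherianRing R] [IsLocalRing R] :
    (GDim.IsCohenMacaulayLocal R → GDim.TotallyReflexiveNewIntersection R) ∧
    ∀ (N : Type u) [AddCommGroup N] [Module R N] [Nontrivial N]
      (X : CochainComplex (ModuleCat.{u} R) ℤ) (P : GDim.ProjRes X),
      (⊤ : Submodule R N).IsPrincipal →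
      projectiveDimension (ModuleCat.of R N) < ⊤ →
      GDim.IsHomologicallyBounded X →
      (∀ i, Module.Finite R (X.homology i)) →
      ¬ X.Acyclic →
      GDim.gdim X < ⊤ →
      GDim.supp (P.derivedTensor N) = {IsLocalRing.closedPoint R} →
      GDim.TotallyReflexiveNewIntersection (R ⧸ Module.annihilator R N) →
      GDim.dimToEReal (Module.supportDim R N) ≤
        GDim.gdim X + GDim.cdim (P.derivedTensor N) :=
  ⟨fun h => h.newIntersection, fun _ _ _ _ _ P hcyc hpd _ _ _ _ hsupp hNI =>
    GDim.supportDim_le_gdim_add_cdim P hcyc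
      (GDim.finProjDim_of_projectiveDimension_lt_top hpd) hsupp hNI⟩
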